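/- **Setting.** Let $\delta>0$, $D=(0,1]^2$, $\mathcal U=(0,1]\times(-\delta,0]$, with periodic boundary conditions at $x=0$, $x=1$ (functions are extended $1$-periodically in $x$, and $\mathcal U$ is regarded as a strip whose vertical sides are glued). Let $h=1/N$ with $N\ge 1$ an integer, $D_h=D\cap h\mathbb Z^2$ and $\mathcal U_h=\mathcal U\cap h\mathbb Z^2$. **Boundary data.** For $s>0$ write $s=k+\alpha$ with $k\in\mathbb N_0$, $0<\alpha\le1$, and let $W^{s,\infty}=C^{k,\alpha}$ (derivatives up to order $k$ bounded, those of order $k$ $\alpha$-Hölder); $W^{0,\infty}$ is the space of bounded functions. Let $M\ge1$, $0<x_1<\dots<x_M\le1$, $L>0$, $T_i=\{(x,y): -\delta\le y\le -L|x-x_i|\}$ (taken periodically in $x$), and let $U_i$ be the part of $\mathcal U$ between $T_{i-1}$ and $T_i$, where $T_0:=T_M$. Let $s>0$, $0\le s'\le s$, and let $u_0:\mathcal U\to\mathbb R$ satisfy $u_0\in W^{s',\infty}(\mathcal U)$ and $u_0\in W^{s,\infty}(U_i)$ for $1\le i\le M$. **The method.** Let $r\ge1$ with $h<\delta/(r+2)$,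 let $A\subset\mathbb R^2$ be a finite set contained in the closed disc of radius $r$ about $0$, and let $\hat w\ge0$ be a weight function. Put $w_r(y)=\hat w(y/r)$ and $$a_r^*=(A\setminus\{0\})\cap\{y_2\le c\},\qquad c=-1\ \text{(direct form)},\quad c=0\ \text{(semi-implicit form)}.$$ The inpainted image $u_h$ equals $u_0$ on $\mathcal U_h$, is periodic in $x$, and $D_h$ is filled row by row from the bottom by $$u_h(\mathbf x)=\frac{\sum_{y\in a_r^*}w_r(y)\,u_h(\mathbf x+hy)}{\sum_{y\in a_r^*}w_r(y)},\qquad \mathbf x\in D_h,$$ where values at points off the lattice $h\mathbb Z^2$ are defined by bilinear interpolation; in the direct form only previously filled rows enter, in the semi-implicit form this is a linear system for the values in the current row. Assume $\sum_{y\in a_r^*}w_r(y)>0$, let $$g_r^*=\frac{\sum_{y\in a_r^*}w_r(y)\,y}{\sum_{y\in a_r^*}w_r(y)}$$ be the centre of mass of the stencil, and assume $g_r^*\cdot e_2\ne0$. Let $\theta_r^*\in(0,\pi)$ be the counter-clockwise angle from the $x$-axis to the line spanned by $g_r^*$, and let $$u(\mathbf x)=u_0(\Pi_{\theta_r^*}(\mathbf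 x)),\qquad \Pi_\theta(x,y)=(x-y\cot\theta \bmod 1,\;0),$$ be the weak solution of $\nabla u\cdot g_r^*=0$ in $D$, $u|_{y=0}=u_0|_{y=0}$, $u|_{x=0}=u|_{x=1}$. For $f:D_h\to\mathbb R$ let $\|f\|_p=\big(\sum_{\mathbf x\in D_h}|f(\mathbf x)|^ph^2\big)^{1/p}$ for $0<p<\infty$ and $\|f\|_\infty=\max_{D_h}|f|$. **Theorem.** The image $u_h$ exists and is unique, and for every $p\in(0,\infty]$ (with $1/\infty:=0$) $$\|u-u_h\|_p\le K\cdot(rh)^{\left(\frac{s'}2+\frac1{2p}\right)\wedge\frac s2\wedge1},\qquad K=K\!\left(\frac{r}{|g_r^*\cdot e_2|},\theta_r^*\right),$$ where the function $K:(0,\infty)\times(0,\pi)\to\mathbb R$ depends only on $u_0,\delta,L,(x_i),s,s'$ (not on $p$, $h$, nor otherwise on $r$, $A$, $\hat w$ or the form of the method). Moreover $K$ can be chosen continuous, strictly increasing in its first argument $r/|g_r^*\cdot e_2|$, and such that, for each fixed first argument, $K\to\infty$ as $\theta_r^*\to0$ or $\theta_r^*\to\pi$. -/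

import Mathlib

open Set Filter Topology
open scoped ENNReal

noncomputable section

namespace Inpainting

/-! ### Function spaces and boundary data

Data that are periodic in the horizontal variable are represented by functions on `ℝ × ℝ` that are
1-periodic in the first variable; subsets of the strip `(0,1] × (-δ,0]`, whose sides are glued,
are represented by their lifts to `ℝ × (-δ,0]`. -/

/-- `u ∈ W^{s,∞}(S)` for a convex set `S` with non-empty interior, as a condition on a function
that is defined pointwise: bounded functions if `s = 0`; if `s > 0`, the Hölder class `C^{k,α}(S)`
with `s = k + α`, `k ∈ ℕ` and `0 < α ≤ 1` (so that `W^{k+1,∞} = C^{k,1}`), all derivatives of order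
at most `k` being bounded. -/
def MemSobolevInf (s : ℝ) (S : Set (ℝ × ℝ)) (u : ℝ × ℝ → ℝ) : Prop :=
  (∃ C, ∀ p ∈ S, |u p| ≤ C) ∧
  (0 < s → ∃ (k : ℕ) (α : ℝ), s = k + α ∧ 0 < α ∧ α ≤ 1 ∧
    ContDiffOn ℝ k u S ∧
    ∃ C, (∀ j ≤ k, ∀ p ∈ S, ‖iteratedFDerivWithin ℝ j u S p‖ ≤ C) ∧
      ∀ p ∈ S, ∀ q ∈ S,
        ‖iteratedFDerivWithin ℝ k u S p - iteratedFDerivWithin ℝ k u S q‖ ≤ C * ‖p - q‖ ^ α)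

/-- The (lifted) undamaged region `𝒰`. -/
def undamaged (δ : ℝ) : Set (ℝ × ℝ) := {p | -δ < p.2 ∧ p.2 ≤ 0}

/-- The closed triangle with tip `(a, 0)` and sides of slope `± L`. -/
def triangle (δ L a : ℝ) : Set (ℝ × ℝ) := {p | -δ ≤ p.2 ∧ p.2 ≤ 0 ∧ p.2 ≤ -L * |a - p.1|}

/-- The tip to the left of the tip `x i`, cyclically: the tip to the left of the first one is the
last one, shifted by one period. -/
def leftTip {M : ℕ} [NeZero M] (x : Fin M → ℝ) (i : Fin M) : ℝ :=
  if i = 0 then x (i - 1) - 1 else x (i - 1)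

/-- The part `U_i` of the undamaged region between the `i`-th triangle and the one to its left. -/
def between {M : ℕ} [NeZero M] (δ L : ℝ) (x : Fin M → ℝ) (i : Fin M) : Set (ℝ × ℝ) :=
  {p ∈ undamaged δ | leftTip x i < p.1 ∧ p.1 < x i} \
    (triangle δ L (leftTip x i) ∪ triangle δ L (x i))

/-! ### The inpainting algorithm

Pixels are indexed by `ℤ × ℤ`: with pixel width `h = 1 / N` the pixel `(j, m)` sits at
`(j h, m h)`. Points between pixels are given in pixel units. -/

/-- Value at a point (a ghost pixel if it is not a pixel) by bilinear interpolation. -/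
def bilinear (v : ℤ × ℤ → ℝ) (p : ℝ × ℝ) : ℝ :=
  (1 - Int.fract p.1) * (1 - Int.fract p.2) * v (⌊p.1⌋, ⌊p.2⌋)
    + Int.fract p.1 * (1 - Int.fract p.2) * v (⌊p.1⌋ + 1, ⌊p.2⌋)
    + (1 - Int.fract p.1) * Int.fract p.2 * v (⌊p.1⌋, ⌊p.2⌋ + 1)
    + Int.fract p.1 * Int.fract p.2 * v (⌊p.1⌋ + 1, ⌊p.2⌋ + 1)

/-- The discrete inpainting domain `D_h^{(k)}` that is left after the `k` lowest rows have been
filled (onion shell order). -/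
def unfilledPixels (N k : ℕ) : Set (ℤ × ℤ) := {z | (k : ℤ) < z.2 ∧ z.2 ≤ N}

/-- The continuous inpainting domain `D^{(k)}`, in pixel units: the points of the image domain at
sup-distance less than one pixel from `D_h^{(k)}`. -/
def unfilledRegion (N k : ℕ) : Set (ℝ × ℝ) :=
  {p | p.2 ≤ N ∧ ∃ z ∈ unfilledPixels N k, |(z.1 : ℝ) - p.1| < 1 ∧ |(z.2 : ℝ) - p.2| < 1}

/-- `Ω \ D^{(k)}`, in pixel units. -/
def readable (N k : ℕ) : Set (ℝ × ℝ) := {p | p.2 ≤ N} \ unfilledRegion N k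

open Classical in
/-- The update formula: the weighted average of `v` over those points of the punctured
neighbourhood `z + A` that lie in `R`. The offsets `A` are in pixel units and `w` is the profile
of the weights, a function of the offset divided by the radius `r`. -/
def update (r : ℝ) (A : Finset (ℝ × ℝ)) (w : ℝ × ℝ → ℝ) (R : Set (ℝ × ℝ)) (v : ℤ × ℤ → ℝ)
    (z : ℤ × ℤ) : ℝ :=
  (∑ y ∈ A with y ≠ 0 ∧ ((z.1 : ℝ), (z.2 : ℝ)) + y ∈ R,
      w (r⁻¹ • y) * bilinear v (((z.1 : ℝ), (z.2 : ℝ)) + y)) /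
    ∑ y ∈ A with y ≠ 0 ∧ ((z.1 : ℝ), (z.2 : ℝ)) + y ∈ R, w (r⁻¹ • y)

/-- The damaged image: the data on and below the row `0`, and `0` on the inpainting domain. -/
def damagedImage (N : ℕ) (u₀ : ℝ × ℝ → ℝ) (z : ℤ × ℤ) : ℝ :=
  if z.2 ≤ 0 then u₀ ((z.1 : ℝ) / N, (z.2 : ℝ) / N) else 0

/-- The two forms of the algorithm. -/
inductive Method
  | direct
  | semiImplicit

/-- One step, from the image `v` in which the rows up to `k` are known to the image `v'` in which
the row `k + 1` is filled too. In the direct form the new values are averages of values known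
before the step; in the semi-implicit form they solve the linear system in which the averages also
involve the unknown values in the current row. -/
def Step (method : Method) (N : ℕ) (r : ℝ) (A : Finset (ℝ × ℝ)) (w : ℝ × ℝ → ℝ) (k : ℕ)
    (v v' : ℤ × ℤ → ℝ) : Prop :=
  (∀ z : ℤ × ℤ, z.2 ≠ k + 1 → v' z = v z) ∧
  ∀ z : ℤ × ℤ, z.2 = k + 1 → v' z =
    match method with
    | .direct => update r A w (readable N k) v z
    | .semiImplicit => update r A w (readable N (k + 1)) v' z

/-- `u` is the image that the algorithm produces, with periodic boundary conditions at the sides of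
the unit square. -/
def IsInpainted (method : Method) (N : ℕ) (r : ℝ) (A : Finset (ℝ × ℝ)) (w : ℝ × ℝ → ℝ)
    (u₀ : ℝ × ℝ → ℝ) (u : ℤ × ℤ → ℝ) : Prop :=
  ∃ v : ℕ → ℤ × ℤ → ℝ, v 0 = damagedImage N u₀ ∧
    (∀ k ≤ N, ∀ z : ℤ × ℤ, v k (z.1 + N, z.2) = v k z) ∧
    (∀ k < N, Step method N r A w k (v k) (v (k + 1))) ∧
    u = v N

open Classical in
/-- The stencil `a_r^*`. -/
def stencil (method : Method) (A : Finset (ℝ × ℝ)) : Finset (ℝ × ℝ) :=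
  match method with
  | .direct => {y ∈ A | y ≠ 0 ∧ y.2 ≤ -1}
  | .semiImplicit => {y ∈ A | y ≠ 0 ∧ y.2 ≤ 0}

/-- The total mass of the stencil weights. -/
def totalMass (method : Method) (r : ℝ) (A : Finset (ℝ × ℝ)) (w : ℝ × ℝ → ℝ) : ℝ :=
  ∑ y ∈ stencil method A, w (r⁻¹ • y)

/-- The centre of mass `g_r^*` of the stencil with respect to the stencil weights. -/
def centerOfMass (method : Method) (r : ℝ) (A : Finset (ℝ × ℝ)) (w : ℝ × ℝ → ℝ) : ℝ × ℝ :=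
  (totalMass method r A w)⁻¹ • ∑ y ∈ stencil method A, w (r⁻¹ • y) • y

/-! ### The continuum limit and the error -/

/-- The counter-clockwise angle in `[0, π)` from the `x`-axis to the line spanned by `g`. -/
def lineAngle (g : ℝ × ℝ) : ℝ := toIcoMod Real.pi_pos 0 (Complex.arg ⟨g.1, g.2⟩)

/-- The transport operator `Π_θ`; the first coordinate is reduced modulo `1` to `(0,1]`. -/
def transport (θ : ℝ) (p : ℝ × ℝ) : ℝ × ℝ :=
  (toIocMod one_pos 0 (p.1 - Real.cot θ * p.2), 0)

/-- The pixels of the inpainting domain `D_h`. -/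
def pixels (N : ℕ) : Finset (ℤ × ℤ) := Finset.Icc 1 (N : ℤ) ×ˢ Finset.Icc 1 (N : ℤ)

/-- The discrete `L^p` norm on `D_h`, for `0 < p ≤ ∞`. -/
def discreteNorm (N : ℕ) (p : ℝ≥0∞) (f : ℤ × ℤ → ℝ) : ℝ :=
  if p = ∞ then (((pixels N).sup fun z => ‖f z‖₊ : NNReal) : ℝ)
  else (∑ z ∈ pixels N, |f z| ^ p.toReal * (1 / (N : ℝ)) ^ 2) ^ (1 / p.toReal)

end Inpainting

end

namespace Inpainting

/-! ### Bilinear interpolation -/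

/-! Write `ε = r h`, let `g` be the centre of mass of the stencil and `c = g₁ / g₂ = cot θ`. Both
forms of the method say the same thing: in each row of the inpainting domain the image equals its
own stencil average `avg`. Bilinear interpolation reproduces affine functions, so `avg` evaluates an
affine function at the centre of mass. Hence affine functions of `ℓ = h (j - c m)`, the coordinate
that is constant along characteristics, solve the scheme exactly (`Admissible.avg_foot`). The
weights are nonnegative and, because `g₂ < 0`, the row being filled carries only a fraction `q < 1`
of the mass. This yields solvability and a comparison principle (`Admissible.nonneg_of_boundary`).

Like a random walk, the scheme spreads the data around the foot `a` of a characteristic over a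
distance `√ε`. This is made precise by barriers: `exp (κ (±(ℓ - a) / √ε + h m))` is a supersolution
for small `κ`, since the second-order term is of size `κ² ε` while the drift gains `κ h |g₂| ≥ κ ε /
Λ` as soon as `r ≤ Λ |g₂|` (`Admissible.avg_exp_foot_le`). A discrete solution whose boundary values
are at most `G exp (κ |ℓ - a| / √ε)` is therefore bounded by a multiple of `G` at every pixel with
foot `a` (`Admissible.abs_le_of_boundary`).

This is applied to the image minus an affine function of `ℓ` with value `u₀ (a, 0)` at `ℓ = a`.
Taylor expansion of the data at `(a, 0)` leaves a remainder of order `ε ^ (min s 2 / 2)` inside one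
region. Elsewhere only `ε ^ (min s' 2 / 2)` is available, but those points are at least about as far
away as the nearest tip, which gives a factor decaying exponentially in the distance from `a` to the
tips over `√ε` (`exists_boundary_bound`). The pointwise error is thus a uniform part plus layers of
width `√ε` (`exists_pointwise_error`), and the `p`-norm of the layers gains `ε ^ (1 / (2p))`
(`discreteNorm_le`). -/

theorem bilinear_add (v v' : ℤ × ℤ → ℝ) (p : ℝ × ℝ) :
    bilinear (fun z => v z + v' z) p = bilinear v p + bilinear v' p := by
  simp only [bilinear]; ring

theorem bilinear_const_mul (c : ℝ) (v : ℤ × ℤ → ℝ) (p : ℝ × ℝ) :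
    bilinear (fun z => c * v z) p = c * bilinear v p := by
  simp only [bilinear]; ring

/-- Bilinear interpolation reproduces affine functions. -/
theorem bilinear_affine (a b c : ℝ) (p : ℝ × ℝ) :
    bilinear (fun z => a + b * z.1 + c * z.2) p = a + b * p.1 + c * p.2 := by
  have h1 := Int.floor_add_fract p.1
  have h2 := Int.floor_add_fract p.2
  simp only [bilinear]
  push_cast
  linear_combination b * h1 + c * h2

/-- Bilinear interpolation at `p` is monotone in the values at the corners of positive weight,
which are those at sup-distance less than `1` from `p`. -/
theorem bilinear_le_bilinear {v v' : ℤ × ℤ → ℝ} {p : ℝ × ℝ}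
    (h : ∀ z : ℤ × ℤ, |(z.1 : ℝ) - p.1| < 1 → |(z.2 : ℝ) - p.2| < 1 → v z ≤ v' z) :
    bilinear v p ≤ bilinear v' p := by
  have low : ∀ t : ℝ, |((⌊t⌋ : ℤ) : ℝ) - t| < 1 := fun t => by
    have h1 := Int.floor_le t
    have h2 := Int.lt_floor_add_one t
    rw [abs_lt]; constructor <;> linarith
  have high : ∀ t : ℝ, Int.fract t ≠ 0 → |((⌊t⌋ + 1 : ℤ) : ℝ) - t| < 1 := fun t ht => by
    have h1 := Int.floor_add_fract t
    have h2 := Int.lt_floor_add_one t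
    have h3 : 0 < Int.fract t := lt_of_le_of_ne (Int.fract_nonneg t) (Ne.symm ht)
    push_cast
    rw [abs_lt]; constructor <;> linarith
  have f1 := Int.fract_nonneg p.1
  have f2 := Int.fract_nonneg p.2
  have e1 : 0 ≤ 1 - Int.fract p.1 := by linarith [Int.fract_lt_one p.1]
  have e2 : 0 ≤ 1 - Int.fract p.2 := by linarith [Int.fract_lt_one p.2]
  have key : ∀ (c : ℝ) (z : ℤ × ℤ), 0 ≤ c →
      (c ≠ 0 → |(z.1 : ℝ) - p.1| < 1 ∧ |(z.2 : ℝ) - p.2| < 1) → c * v z ≤ c * v' z := by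
    intro c z hc hz
    by_cases h0 : c = 0
    · simp [h0]
    · exact mul_le_mul_of_nonneg_left (h z (hz h0).1 (hz h0).2) hc
  simp only [bilinear]
  refine add_le_add (add_le_add (add_le_add ?_ ?_) ?_) ?_
  · exact key _ _ (mul_nonneg e1 e2) fun _ => ⟨low _, low _⟩
  · exact key _ _ (mul_nonneg f1 e2) fun h0 => ⟨high _ (left_ne_zero_of_mul h0), low _⟩
  · exact key _ _ (mul_nonneg e1 f2) fun h0 => ⟨low _, high _ (right_ne_zero_of_mul h0)⟩
  · exact key _ _ (mul_nonneg f1 f2) fun h0 =>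
      ⟨high _ (left_ne_zero_of_mul h0), high _ (right_ne_zero_of_mul h0)⟩

/-! ### The averaging operator -/

/-- The weighted average of the interpolated image over the translated stencil `z + S`. -/
noncomputable def avg (S : Finset (ℝ × ℝ)) (ω : ℝ × ℝ → ℝ) (v : ℤ × ℤ → ℝ) (z : ℤ × ℤ) : ℝ :=
  (∑ y ∈ S, ω y * bilinear v (((z.1 : ℝ), (z.2 : ℝ)) + y)) / ∑ y ∈ S, ω y

/-- The centre of mass of a weighted finite set. -/
noncomputable def barycenter (S : Finset (ℝ × ℝ)) (ω : ℝ × ℝ → ℝ) : ℝ × ℝ :=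
  (∑ y ∈ S, ω y)⁻¹ • ∑ y ∈ S, ω y • y

/-- Weighted stencils of radius `r` in the closed lower half-plane, not supported on the axis. -/
structure Admissible (r : ℝ) (S : Finset (ℝ × ℝ)) (ω : ℝ × ℝ → ℝ) : Prop where
  one_le : 1 ≤ r
  nonneg : ∀ y, 0 ≤ ω y
  mass_pos : 0 < ∑ y ∈ S, ω y
  abs_fst_le : ∀ y ∈ S, |y.1| ≤ r
  le_snd : ∀ y ∈ S, -r ≤ y.2
  snd_nonpos : ∀ y ∈ S, y.2 ≤ 0
  drift : (barycenter S ω).2 < 0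

section avg

variable {r : ℝ} {S : Finset (ℝ × ℝ)} {ω : ℝ × ℝ → ℝ}

theorem avg_add (v v' : ℤ × ℤ → ℝ) (z : ℤ × ℤ) :
    avg S ω (fun z => v z + v' z) z = avg S ω v z + avg S ω v' z := by
  simp only [avg, bilinear_add, mul_add, Finset.sum_add_distrib, add_div]

theorem avg_const_mul (c : ℝ) (v : ℤ × ℤ → ℝ) (z : ℤ × ℤ) :
    avg S ω (fun z => c * v z) z = c * avg S ω v z := by
  simp only [avg, bilinear_const_mul, mul_left_comm _ c, ← Finset.mul_sum, mul_div_assoc]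

theorem avg_sub (v v' : ℤ × ℤ → ℝ) (z : ℤ × ℤ) :
    avg S ω (fun z => v z - v' z) z = avg S ω v z - avg S ω v' z := by
  have := avg_add (S := S) (ω := ω) v (fun z => (-1) * v' z) z
  rw [avg_const_mul] at this
  simpa [sub_eq_add_neg] using this

theorem barycenter_fst : (barycenter S ω).1 = (∑ y ∈ S, ω y * y.1) / ∑ y ∈ S, ω y := by
  simp [barycenter, Prod.fst_sum, div_eq_inv_mul]

theorem barycenter_snd : (barycenter S ω).2 = (∑ y ∈ S, ω y * y.2) / ∑ y ∈ S, ω y := by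
  simp [barycenter, Prod.snd_sum, div_eq_inv_mul]

/-- The interpolation is exact on affine functions, so only the first moments of the weights enter.
-/
theorem avg_affine (hW : ∑ y ∈ S, ω y ≠ 0) (a b c : ℝ) (z : ℤ × ℤ) :
    avg S ω (fun z => a + b * z.1 + c * z.2) z =
      a + b * (z.1 + (barycenter S ω).1) + c * (z.2 + (barycenter S ω).2) := by
  have key : ∑ y ∈ S, ω y * (a + b * (z.1 + y.1) + c * (z.2 + y.2)) =
      (a + b * z.1 + c * z.2) * ∑ y ∈ S, ω y + b * ∑ y ∈ S, ω y * y.1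
        + c * ∑ y ∈ S, ω y * y.2 := by
    simp only [Finset.mul_sum, ← Finset.sum_add_distrib]
    exact Finset.sum_congr rfl fun y _ => by ring
  simp only [avg, bilinear_affine, Prod.fst_add, Prod.snd_add, barycenter_fst, barycenter_snd, key]
  field_simp
  ring

/-! ### Monotonicity, maximum principle and comparison -/

namespace Admissible

/-- A corner of positive interpolation weight is at distance less than one from a stencil point,
which widens the window from `r` to `r + 1`. Stencil points do not lie above the current row, and a
corner of integer height less than one above that row is not above it either. -/
theorem avg_le_avg (hS : Admissible r S ω) {v v' : ℤ × ℤ → ℝ} {z : ℤ × ℤ}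
    (h : ∀ ζ : ℤ × ℤ, |(ζ.1 : ℝ) - z.1| < r + 1 → (z.2 : ℝ) - (r + 1) < ζ.2 → ζ.2 ≤ z.2 →
      v ζ ≤ v' ζ) : avg S ω v z ≤ avg S ω v' z := by
  refine div_le_div_of_nonneg_right (Finset.sum_le_sum fun y hy => ?_) hS.mass_pos.le
  refine mul_le_mul_of_nonneg_left (bilinear_le_bilinear fun ζ h1 h2 => ?_) (hS.nonneg y)
  have hy1 := abs_le.1 (hS.abs_fst_le y hy)
  have hy2 := hS.le_snd y hy
  have hy3 := hS.snd_nonpos y hy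
  simp only [Prod.fst_add, Prod.snd_add, abs_lt] at h1 h2
  refine h ζ ?_ (by linarith) ?_
  · rw [abs_lt]; constructor <;> linarith
  · have : (ζ.2 : ℝ) < z.2 + 1 := by linarith
    exact Int.lt_add_one_iff.1 (by exact_mod_cast this)

theorem avg_congr (hS : Admissible r S ω) {v v' : ℤ × ℤ → ℝ} {z : ℤ × ℤ}
    (h : ∀ ζ : ℤ × ℤ, ζ.2 ≤ z.2 → v ζ = v' ζ) : avg S ω v z = avg S ω v' z :=
  le_antisymm (hS.avg_le_avg fun ζ _ _ h3 => (h ζ h3).le)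
    (hS.avg_le_avg fun ζ _ _ h3 => (h ζ h3).ge)

theorem neg_le_barycenter_snd (hS : Admissible r S ω) : -r ≤ (barycenter S ω).2 := by
  rw [barycenter_snd, le_div_iff₀ hS.mass_pos, Finset.mul_sum]
  refine Finset.sum_le_sum fun y hy => ?_
  nlinarith [hS.nonneg y, hS.le_snd y hy]

theorem abs_barycenter_fst_le (hS : Admissible r S ω) : |(barycenter S ω).1| ≤ r := by
  rw [barycenter_fst, abs_div, abs_of_pos hS.mass_pos, div_le_iff₀ hS.mass_pos, Finset.mul_sum]
  refine (Finset.abs_sum_le_sum_abs _ _).trans (Finset.sum_le_sum fun y hy => ?_)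
  rw [abs_mul, abs_of_nonneg (hS.nonneg y), mul_comm]
  exact mul_le_mul_of_nonneg_right (hS.abs_fst_le y hy) (hS.nonneg y)

/-- The fraction of the mass that a stencil can place on its top row is at most this. -/
theorem contraction_factor (hS : Admissible r S ω) :
    0 ≤ 1 + (barycenter S ω).2 / (r + 1) ∧ 1 + (barycenter S ω).2 / (r + 1) < 1 := by
  have h1 := hS.one_le
  have h2 := hS.neg_le_barycenter_snd
  have h3 := hS.drift
  have h4 : (0 : ℝ) < r + 1 := by linarith
  constructor
  · have : -1 ≤ (barycenter S ω).2 / (r + 1) := by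
      rw [le_div_iff₀ h4]; linarith
    linarith
  · linarith [div_neg_of_neg_of_pos h3 h4]

/-- A function that is non-negative below a row and bounded below by `-c` on it has averages
bounded below by `-q c` there, with a fixed `q < 1`. -/
theorem le_avg_of_row (hS : Admissible r S ω) {F : ℤ × ℤ → ℝ} {c : ℝ} (hc : 0 ≤ c) {z : ℤ × ℤ}
    (hlow : ∀ ζ : ℤ × ℤ, (z.2 : ℝ) - (r + 1) < ζ.2 → ζ.2 < z.2 → 0 ≤ F ζ)
    (hrow : ∀ ζ : ℤ × ℤ, ζ.2 = z.2 → -c ≤ F ζ) :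
    -((1 + (barycenter S ω).2 / (r + 1)) * c) ≤ avg S ω F z := by
  have h1 := hS.one_le
  have h4 : (0 : ℝ) < r + 1 := by linarith
  -- The comparison function is affine in the row: `-c` on the row of `z`, zero at depth `r + 1`
  -- below it. Its value at the centre of mass produces the factor `1 + g₂ / (r + 1)`.
  have := hS.avg_le_avg (v := fun ζ => (-c * (1 - z.2 / (r + 1))) + 0 * ζ.1 + (-c / (r + 1)) * ζ.2)
    (v' := F) (z := z) (fun ζ _ h2 h3 => by
      have e : (-c * (1 - z.2 / (r + 1))) + 0 * ζ.1 + (-c / (r + 1)) * ζ.2 =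
        -(c * (((r + 1) + (ζ.2 - z.2)) / (r + 1))) := by field_simp; ring
      rw [e]
      rcases h3.lt_or_eq with h | h
      · have : 0 ≤ c * (((r + 1) + (ζ.2 - z.2)) / (r + 1)) :=
          mul_nonneg hc (div_nonneg (by linarith) h4.le)
        linarith [hlow ζ h2 h]
      · have := hrow ζ h
        rw [h]; simpa [h4.ne'] using this)
  rw [avg_affine hS.mass_pos.ne'] at this
  refine le_of_eq_of_le ?_ this
  field_simp
  ring

/-- Maximum principle in one row. -/
theorem row_nonneg (hS : Admissible r S ω) {F : ℤ × ℤ → ℝ} {m : ℤ}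
    (hlow : ∀ ζ : ℤ × ℤ, (m : ℝ) - (r + 1) < ζ.2 → ζ.2 < m → 0 ≤ F ζ)
    (hbdd : ∃ c, ∀ ζ : ℤ × ℤ, ζ.2 = m → -c ≤ F ζ)
    (hsup : ∀ ζ : ℤ × ℤ, ζ.2 = m → avg S ω F ζ ≤ F ζ) (z : ℤ × ℤ) (hz : z.2 = m) : 0 ≤ F z := by
  obtain ⟨c, hc⟩ := hbdd
  obtain ⟨q0, q1⟩ := hS.contraction_factor
  set q := 1 + (barycenter S ω).2 / (r + 1)
  -- Every further averaging improves the lower bound on the row by the factor `q`; boundedness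
  -- starts the iteration.
  have key : ∀ n : ℕ, ∀ ζ : ℤ × ℤ, ζ.2 = m → -(q ^ n * max c 0) ≤ F ζ := by
    intro n
    induction n with
    | zero => intro ζ hζ; have := hc ζ hζ; simp only [pow_zero, one_mul]
              linarith [le_max_left c 0]
    | succ n ih =>
      intro ζ hζ
      refine le_trans ?_ (hsup ζ hζ)
      have := hS.le_avg_of_row (F := F) (c := q ^ n * max c 0) (z := ζ)
        (mul_nonneg (pow_nonneg q0 n) (le_max_right _ _)) (by rw [hζ]; exact hlow)
        (fun ξ hξ => ih ξ (hξ.trans hζ))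
      rwa [pow_succ', mul_assoc]
  have lim : Tendsto (fun n : ℕ => -(q ^ n * max c 0)) atTop (𝓝 (-(0 * max c 0))) :=
    ((tendsto_pow_atTop_nhds_zero_of_lt_one q0 q1).mul_const _).neg
  rw [zero_mul, neg_zero] at lim
  exact le_of_tendsto' lim fun n => key n z hz

/-- Comparison principle. -/
theorem nonneg_of_boundary (hS : Admissible r S ω) {F : ℤ × ℤ → ℝ} {n : ℕ}
    (hbd : ∀ z : ℤ × ℤ, -r < z.2 → z.2 ≤ 0 → 0 ≤ F z)
    (hbdd : ∃ c, ∀ z : ℤ × ℤ, 1 ≤ z.2 → z.2 ≤ n → -c ≤ F z)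
    (hsup : ∀ z : ℤ × ℤ, 1 ≤ z.2 → z.2 ≤ n → avg S ω F z ≤ F z) :
    ∀ m : ℕ, m ≤ n → ∀ z : ℤ × ℤ, -r < z.2 → z.2 ≤ m → 0 ≤ F z := by
  intro m
  induction m with
  | zero => intro _ z h1 h2; exact hbd z h1 (by simpa using h2)
  | succ m ih =>
    intro hm z h1 h2
    rcases h2.lt_or_eq with h | h
    · exact ih (by omega) z h1 (by push_cast at h; omega)
    · obtain ⟨c, hc⟩ := hbdd
      refine hS.row_nonneg (m := z.2) (fun ζ h3 h4 => ih (by omega) ζ ?_ ?_)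
        ⟨c, fun ζ hζ => hc ζ ?_ ?_⟩ (fun ζ hζ => hsup ζ ?_ ?_) z rfl
      · have : (1 : ℝ) ≤ z.2 := by rw [h]; push_cast; linarith [(Nat.cast_nonneg m : (0 : ℝ) ≤ m)]
        linarith
      all_goals push_cast at h; omega

end Admissible

end avg

/-! ### Exponential barriers of width `√(r h)` -/

section exponential

variable {r : ℝ} {S : Finset (ℝ × ℝ)} {ω : ℝ × ℝ → ℝ}

/-- Exponentials of affine functions that decrease in the direction of the drift are
supersolutions if the slope is small. -/
theorem Admissible.avg_exp_le (hS : Admissible r S ω) {κ a b c D : ℝ} (hκ : 0 ≤ κ)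
    (hD : (|b| + |c|) * (r + 1) ≤ D) (hκD : κ * D ≤ 1)
    (hdrift : κ * D ^ 2 ≤ -(b * (barycenter S ω).1 + c * (barycenter S ω).2)) (z : ℤ × ℤ) :
    avg S ω (fun ζ => Real.exp (κ * (a + b * ζ.1 + c * ζ.2))) z
      ≤ Real.exp (κ * (a + b * z.1 + c * z.2)) := by
  have hr := hS.one_le
  have hD0 : 0 ≤ D := le_trans (by positivity) hD
  set E := Real.exp (κ * (a + b * z.1 + c * z.2)) with hE
  have hE0 : 0 < E := Real.exp_pos _
  -- The exponential is replaced by the affine majorant coming from `exp t ≤ 1 + t + t²` for `|t| ≤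
  -- 1`, with `t²` bounded by `(κ D)²`. The average of the majorant is explicit, and the drift
  -- condition absorbs the quadratic term.
  refine (hS.avg_le_avg (v' := fun ζ => E * (1 + (κ * D) ^ 2 - κ * (b * z.1 + c * z.2))
    + E * (κ * b) * ζ.1 + E * (κ * c) * ζ.2) fun ζ h1 h2 h3 => ?_).trans ?_
  · set t := κ * (b * (ζ.1 - z.1) + c * (ζ.2 - z.2)) with ht
    have h3' : (ζ.2 : ℝ) ≤ z.2 := by exact_mod_cast h3
    have habs : |(ζ.2 : ℝ) - z.2| ≤ r + 1 := by rw [abs_le]; constructor <;> linarith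
    have htD : |t| ≤ κ * D := by
      rw [ht, abs_mul, abs_of_nonneg hκ]
      refine mul_le_mul_of_nonneg_left (le_trans ?_ hD) hκ
      refine (abs_add_le _ _).trans ?_
      rw [abs_mul, abs_mul, add_mul]
      exact add_le_add (mul_le_mul_of_nonneg_left h1.le (abs_nonneg _))
        (mul_le_mul_of_nonneg_left habs (abs_nonneg _))
    have hexp := (abs_le.1 (Real.abs_exp_sub_one_sub_id_le (htD.trans hκD))).2
    have hsq : t ^ 2 ≤ (κ * D) ^ 2 := by
      rw [← sq_abs t]; exact pow_le_pow_left₀ (abs_nonneg _) htD 2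
    have e : Real.exp (κ * (a + b * ζ.1 + c * ζ.2)) = E * Real.exp t := by
      rw [hE, ← Real.exp_add]; congr 1; rw [ht]; ring
    rw [e]
    have : E * Real.exp t ≤ E * (1 + t + (κ * D) ^ 2) :=
      mul_le_mul_of_nonneg_left (by linarith) hE0.le
    refine this.trans (le_of_eq ?_)
    rw [ht]; ring
  · rw [avg_affine hS.mass_pos.ne']
    have := mul_le_mul_of_nonneg_left hdrift (mul_nonneg hE0.le hκ)
    nlinarith

/-- The rate of the exponential bounds. -/
noncomputable def rate (Λ δ : ℝ) : ℝ := 1 / (4 * Λ * (1 + Λ + √δ) ^ 2)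

theorem rate_pos {Λ : ℝ} (hΛ : 1 ≤ Λ) (δ : ℝ) : 0 < rate Λ δ := by
  have := Real.sqrt_nonneg δ
  unfold rate; positivity

theorem rate_le_one {Λ : ℝ} (hΛ : 1 ≤ Λ) (δ : ℝ) : rate Λ δ ≤ 1 := by
  have := Real.sqrt_nonneg δ
  unfold rate
  rw [div_le_one (by positivity)]
  nlinarith [sq_nonneg (Λ + √δ), mul_nonneg (by linarith : (0:ℝ) ≤ Λ) this,
    sq_nonneg (1 + Λ + √δ)]

/-- The horizontal position, for pixel width `h`, of the foot of the characteristic through the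
pixel `z`, if the characteristics have slope `1 / c`. -/
noncomputable def foot (h c : ℝ) (z : ℤ × ℤ) : ℝ := h * (z.1 - c * z.2)

theorem foot_eq_affine (h c : ℝ) (z : ℤ × ℤ) : foot h c z = 0 + h * z.1 + (-(h * c)) * z.2 := by
  simp only [foot]; ring

/-- The position of the foot is a discrete solution. -/
theorem Admissible.avg_foot (hS : Admissible r S ω) (h : ℝ) (z : ℤ × ℤ) :
    avg S ω (foot h ((barycenter S ω).1 / (barycenter S ω).2)) z =
      foot h ((barycenter S ω).1 / (barycenter S ω).2) z := by
  have hg := hS.drift.ne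
  have e : foot h ((barycenter S ω).1 / (barycenter S ω).2) = fun z : ℤ × ℤ => 0 + h * (z.1 : ℝ) +
      (-(h * ((barycenter S ω).1 / (barycenter S ω).2))) * (z.2 : ℝ) :=
    funext fun z => foot_eq_affine h _ z
  rw [e, avg_affine hS.mass_pos.ne']
  field_simp
  ring

/-- The foot coordinate does not change under the drift, so the whole gain is `h |g₂|`, from the
term `h * ζ.2`. The oscillation over the stencil is at most `D = 2 √(r h) (1 + Λ + √δ)`, and `rate`
is chosen to make `κ D² = r h / Λ ≤ h |g₂|`. -/
theorem Admissible.avg_exp_foot_le (hS : Admissible r S ω) {Λ δ h : ℝ} (hΛ : 1 ≤ Λ)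
    (hh : 0 < h) (hrh : r * h ≤ δ) (hg : r ≤ Λ * |(barycenter S ω).2|) (a : ℝ) {τ : ℝ}
    (hτ : |τ| = 1) (z : ℤ × ℤ) :
    avg S ω (fun ζ => Real.exp (rate Λ δ *
      (τ * ((foot h ((barycenter S ω).1 / (barycenter S ω).2) ζ - a) / √(r * h)) + h * ζ.2))) z ≤
      Real.exp (rate Λ δ *
      (τ * ((foot h ((barycenter S ω).1 / (barycenter S ω).2) z - a) / √(r * h)) + h * z.2)) := by
  have hr := hS.one_le
  have hg2 := hS.drift
  set g := barycenter S ω with hgdef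
  have hε : 0 < r * h := by positivity
  set σ := √(r * h) with hσ
  have hσ0 : 0 < σ := Real.sqrt_pos.2 hε
  have hσσ : σ * σ = r * h := Real.mul_self_sqrt hε.le
  have hσδ : σ ≤ √δ := Real.sqrt_le_sqrt hrh
  set X := 1 + Λ + √δ with hX
  have hX0 : 0 < X := by positivity
  have hg2' : |g.2| = -g.2 := abs_of_neg hg2
  have hc : |g.1 / g.2| ≤ Λ := by
    rw [abs_div, div_le_iff₀ (abs_pos.2 hg2.ne)]
    exact hS.abs_barycenter_fst_le.trans hg
  have key := hS.avg_exp_le (κ := rate Λ δ) (a := -(τ * (a / σ))) (b := τ * (h / σ))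
    (c := -(τ * (h / σ) * (g.1 / g.2)) + h) (D := 2 * σ * X) (rate_pos hΛ δ).le ?_ ?_ ?_ z
  · have e : ∀ ζ : ℤ × ℤ, -(τ * (a / σ)) + τ * (h / σ) * (ζ.1 : ℝ) +
        (-(τ * (h / σ) * (g.1 / g.2)) + h) * (ζ.2 : ℝ) =
        τ * ((foot h (g.1 / g.2) ζ - a) / σ) + h * ζ.2 := by
      intro ζ; simp only [foot]; field_simp; ring
    simpa only [e] using key
  · have h1 : |τ * (h / σ)| = h / σ := by
      rw [abs_mul, hτ, one_mul, abs_of_pos (by positivity)]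
    have h2 : |-(τ * (h / σ) * (g.1 / g.2)) + h| ≤ h / σ * Λ + h := by
      refine (abs_add_le _ _).trans ?_
      rw [abs_neg, abs_mul, h1, abs_of_pos hh]
      gcongr
    rw [h1]
    have h3 : h * (r + 1) ≤ 2 * (σ * σ) := by rw [hσσ]; nlinarith
    calc (h / σ + |-(τ * (h / σ) * (g.1 / g.2)) + h|) * (r + 1)
        ≤ (h / σ + (h / σ * Λ + h)) * (r + 1) := by gcongr
      _ = (h * (r + 1)) * ((1 + Λ + σ) / σ) := by field_simp; ring
      _ ≤ (2 * (σ * σ)) * (X / σ) := by gcongr; linarith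
      _ = 2 * σ * X := by field_simp
  · have : 2 * σ * X ≤ 4 * Λ * X ^ 2 := by
      have h1 : σ ≤ X := by linarith
      have h2 : σ * X ≤ X * X := by gcongr
      have h3 : X * X ≤ Λ * (X * X) := le_mul_of_one_le_left (by positivity) hΛ
      nlinarith
    unfold rate
    rw [← hX, one_div, inv_mul_le_iff₀ (by positivity), mul_one]
    exact this
  · have e1 : τ * (h / σ) * g.1 + (-(τ * (h / σ) * (g.1 / g.2)) + h) * g.2 = h * g.2 := by
      have := hg2.ne
      field_simp
      ring
    have e2 : rate Λ δ * (2 * σ * X) ^ 2 = r * h / Λ := by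
      have : (2 * σ * X) ^ 2 = 4 * (r * h) * X ^ 2 := by rw [← hσσ]; ring
      rw [this]; unfold rate; rw [← hX]; field_simp
    rw [e1, e2, div_le_iff₀ (by linarith)]
    rw [hg2'] at hg
    linarith [mul_le_mul_of_nonneg_right hg hh.le]

/-- Pointwise bound for discrete solutions by means of an exponential bound for the boundary
values. -/
theorem Admissible.abs_le_of_boundary (hS : Admissible r S ω) {Λ δ h G a : ℝ} {n : ℕ} (hΛ : 1 ≤ Λ)
    (hh : 0 < h) (hrh : r * h ≤ δ) (hn : n * h ≤ 1) (hg : r ≤ Λ * |(barycenter S ω).2|)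
    (hG : 0 < G) {c : ℝ} (hc : c = (barycenter S ω).1 / (barycenter S ω).2) {V : ℤ × ℤ → ℝ}
    (hV : ∀ z : ℤ × ℤ, 1 ≤ z.2 → z.2 ≤ n → avg S ω V z = V z)
    (hgrowth : ∃ C, ∀ z : ℤ × ℤ, 1 ≤ z.2 → z.2 ≤ n → |V z| ≤ C * (1 + |foot h c z - a|))
    (hbd : ∀ z : ℤ × ℤ, -r < z.2 → z.2 ≤ 0 →
      |V z| ≤ G * Real.exp (rate Λ δ * (|foot h c z - a| / √(r * h))))
    {z : ℤ × ℤ} (hz1 : 1 ≤ z.2) (hzn : z.2 ≤ n) (hza : foot h c z = a) :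
    |V z| ≤ 2 * Real.exp (1 + δ) * G := by
  have hr := hS.one_le
  have hε : 0 < r * h := by positivity
  set κ := rate Λ δ with hκ
  have hκ0 : 0 < κ := rate_pos hΛ δ
  have hκ1 : κ ≤ 1 := rate_le_one hΛ δ
  set σ := √(r * h) with hσ
  have hσ0 : 0 < σ := Real.sqrt_pos.2 hε
  -- The two one-sided barriers are smooth in `ℓ`, and their sum dominates the exponential of the
  -- absolute value.
  set B : ℝ → ℤ × ℤ → ℝ := fun τ ζ => Real.exp (κ * (τ * ((foot h c ζ - a) / σ) + h * ζ.2)) with hB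
  have hBsup : ∀ τ : ℝ, |τ| = 1 → ∀ ζ, avg S ω (B τ) ζ ≤ B τ ζ := by
    intro τ hτ ζ
    simp only [hB, hc, hκ, hσ]
    exact hS.avg_exp_foot_le hΛ hh hrh hg a hτ ζ
  have hBge : ∀ ζ : ℤ × ℤ, Real.exp (κ * (|foot h c ζ - a| / σ)) * Real.exp (κ * (h * ζ.2)) ≤
      B 1 ζ + B (-1) ζ := by
    intro ζ
    rw [← Real.exp_add]
    rcases abs_cases (foot h c ζ - a) with ⟨e, _⟩ | ⟨e, _⟩
    · rw [e]
      refine le_trans (le_of_eq ?_) (le_add_of_nonneg_right (Real.exp_pos _).le)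
      simp only [hB]; congr 1; ring
    · rw [e]
      refine le_trans (le_of_eq ?_) (le_add_of_nonneg_left (Real.exp_pos _).le)
      simp only [hB]; congr 1; ring
  -- In the boundary rows `h m ≥ -r h ≥ -δ`, so the barriers lose at most the factor `exp (κ δ)`
  -- there, which `H` restores.
  set H := G * Real.exp (κ * δ) with hH
  have hH0 : 0 < H := by positivity
  have main : ∀ s : ℝ, |s| = 1 → 0 ≤ H * (B 1 z + B (-1) z) - s * V z := by
    intro s hs
    refine hS.nonneg_of_boundary (F := fun ζ => H * (B 1 ζ + B (-1) ζ) - s * V ζ) (n := n)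
      (fun ζ h1 h2 => ?_) ?_ (fun ζ h1 h2 => ?_) n le_rfl z ?_ hzn
    · have hsV : s * V ζ ≤ |V ζ| := by
        have := le_abs_self (s * V ζ); rwa [abs_mul, hs, one_mul] at this
      have h3 : Real.exp (-(κ * δ)) ≤ Real.exp (κ * (h * ζ.2)) := by
        rw [Real.exp_le_exp, ← mul_neg]
        refine mul_le_mul_of_nonneg_left ?_ hκ0.le
        nlinarith
      have h4 : G * Real.exp (κ * (|foot h c ζ - a| / σ)) ≤ H * (B 1 ζ + B (-1) ζ) := by
        calc G * Real.exp (κ * (|foot h c ζ - a| / σ))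
            = H * (Real.exp (κ * (|foot h c ζ - a| / σ)) * Real.exp (-(κ * δ))) := by
              rw [hH, Real.exp_neg]; field_simp
          _ ≤ H * (Real.exp (κ * (|foot h c ζ - a| / σ)) * Real.exp (κ * (h * ζ.2))) := by
              gcongr
          _ ≤ _ := by gcongr; exact hBge ζ
      linarith [hbd ζ h1 h2]
    · obtain ⟨C, hC⟩ := hgrowth
      -- The barrier grows at least quadratically in `x` and `V` at most linearly; this constant
      -- comes from completing the square.
      refine ⟨C + (C * σ) ^ 2 / (2 * H * κ ^ 2), fun ζ h1 h2 => ?_⟩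
      have hsV : s * V ζ ≤ |V ζ| := by
        have := le_abs_self (s * V ζ); rwa [abs_mul, hs, one_mul] at this
      have h3 := hC ζ h1 h2
      have h4 := hBge ζ
      set x := |foot h c ζ - a| / σ with hx
      have hx0 : 0 ≤ x := by positivity
      have hxσ : |foot h c ζ - a| = σ * x := by rw [hx]; field_simp
      rw [hxσ] at h3
      have h5 : (1 : ℝ) ≤ Real.exp (κ * (h * ζ.2)) := by
        have : (0 : ℝ) ≤ ζ.2 := by exact_mod_cast (by omega : 0 ≤ ζ.2)
        exact Real.one_le_exp (by positivity)
      have h6 := Real.quadratic_le_exp_of_nonneg (mul_nonneg hκ0.le hx0)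
      have h7 : (κ * x) ^ 2 / 2 ≤ B 1 ζ + B (-1) ζ := by
        refine le_trans ?_ h4
        refine le_trans ?_ (le_mul_of_one_le_right (Real.exp_pos _).le h5)
        have : 0 ≤ κ * x := by positivity
        linarith
      have h8 : H * ((κ * x) ^ 2 / 2) ≤ H * (B 1 ζ + B (-1) ζ) := by gcongr
      have h9 : 0 ≤ H * ((κ * x) ^ 2 / 2) - C * σ * x + (C * σ) ^ 2 / (2 * H * κ ^ 2) := by
        have : H * ((κ * x) ^ 2 / 2) - C * σ * x + (C * σ) ^ 2 / (2 * H * κ ^ 2) =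
          (H * κ ^ 2 * x - C * σ) ^ 2 / (2 * H * κ ^ 2) := by field_simp; ring
        rw [this]; positivity
      linarith
    · rw [avg_sub (fun ζ => H * (B 1 ζ + B (-1) ζ)) (fun ζ => s * V ζ),
        avg_const_mul H (fun ζ => B 1 ζ + B (-1) ζ), avg_add, avg_const_mul, hV ζ h1 h2]
      have h3 := hBsup 1 (by simp) ζ
      have h4 := hBsup (-1) (by simp) ζ
      have : H * (avg S ω (B 1) ζ + avg S ω (B (-1)) ζ) ≤ H * (B 1 ζ + B (-1) ζ) := by gcongr
      linarith
    · have : (1 : ℝ) ≤ z.2 := by exact_mod_cast hz1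
      linarith
  have hBz : ∀ τ, B τ z ≤ Real.exp 1 := by
    intro τ
    simp only [hB, hza, sub_self, zero_div, mul_zero, zero_add]
    rw [Real.exp_le_exp]
    have h1 : (z.2 : ℝ) ≤ n := by exact_mod_cast hzn
    have h2 : h * z.2 ≤ 1 := by nlinarith
    have h3 : (1 : ℝ) ≤ z.2 := by exact_mod_cast hz1
    have h4 : 0 ≤ h * z.2 := by nlinarith
    nlinarith
  have hHle : H ≤ G * Real.exp δ := by
    refine mul_le_mul_of_nonneg_left (Real.exp_le_exp.2 ?_) hG.le
    nlinarith
  have hfin : H * (B 1 z + B (-1) z) ≤ 2 * Real.exp (1 + δ) * G := by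
    calc H * (B 1 z + B (-1) z) ≤ G * Real.exp δ * (Real.exp 1 + Real.exp 1) := by
          gcongr
          exacts [hBz 1, hBz (-1)]
      _ = _ := by rw [Real.exp_add]; ring
  rw [abs_le]
  constructor
  · linarith [main (-1) (by simp)]
  · linarith [main 1 (by simp)]

end exponential

/-! ### Unique solvability of the row equations -/

section wellposed

variable {r : ℝ} {S : Finset (ℝ × ℝ)} {ω : ℝ × ℝ → ℝ}

/-- Images that are periodic in the horizontal direction. -/
def HPeriodic (N : ℕ) (v : ℤ × ℤ → ℝ) : Prop := ∀ z : ℤ × ℤ, v (z.1 + N, z.2) = v z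

theorem HPeriodic.add_mul {N : ℕ} {v : ℤ × ℤ → ℝ} (hv : HPeriodic N v) (j m k : ℤ) :
    v (j + k * N, m) = v (j, m) := by
  have h : Function.Periodic (fun j : ℤ => v (j, m)) N := fun j => hv (j, m)
  exact h.int_mul k j

theorem HPeriodic.eq_of_modEq {N : ℕ} {v : ℤ × ℤ → ℝ} (hv : HPeriodic N v) {i j : ℤ} (m : ℤ)
    (h : (i : ZMod N) = j) : v (i, m) = v (j, m) := by
  obtain ⟨k, hk⟩ := (ZMod.intCast_eq_intCast_iff_dvd_sub i j N).1 h
  have := hv.add_mul i m k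
  rw [← this]
  congr 2
  linarith

theorem HPeriodic.bounded {N : ℕ} (hN : 0 < N) {v : ℤ × ℤ → ℝ} (hv : HPeriodic N v) (m : ℤ) :
    ∃ C, ∀ z : ℤ × ℤ, z.2 = m → |v z| ≤ C := by
  have : NeZero N := ⟨hN.ne'⟩
  refine ⟨∑ i : ZMod N, |v ((i.val : ℤ), m)|, fun z hz => ?_⟩
  have e : v z = v ((((z.1 : ZMod N)).val : ℤ), m) := by
    rw [← hz]
    exact hv.eq_of_modEq z.2 (by simp)
  rw [e]
  exact Finset.single_le_sum (f := fun i : ZMod N => |v ((i.val : ℤ), m)|)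
    (fun _ _ => abs_nonneg _) (Finset.mem_univ _)

theorem HPeriodic.bounded_rows {N : ℕ} (hN : 0 < N) {v : ℤ × ℤ → ℝ} (hv : HPeriodic N v)
    (a b : ℤ) : ∃ C, ∀ z : ℤ × ℤ, a ≤ z.2 → z.2 ≤ b → |v z| ≤ C := by
  choose C hC using fun m => hv.bounded hN m
  refine ⟨∑ m ∈ Finset.Icc a b, |C m|, fun z h1 h2 => ?_⟩
  refine (hC z.2 z rfl).trans ((le_abs_self _).trans ?_)
  exact Finset.single_le_sum (f := fun m => |C m|) (fun _ _ => abs_nonneg _)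
    (Finset.mem_Icc.2 ⟨h1, h2⟩)

theorem avg_hperiodic {N : ℕ} {v : ℤ × ℤ → ℝ} (hv : HPeriodic N v) : HPeriodic N (avg S ω v) := by
  intro z
  have key : ∀ p : ℝ × ℝ, bilinear v (p.1 + N, p.2) = bilinear v p := by
    intro p
    have h1 : ∀ i m : ℤ, v (i + N, m) = v (i, m) := fun i m => hv (i, m)
    have h2 : ∀ i m : ℤ, v (i + N + 1, m) = v (i + 1, m) := fun i m => by
      rw [add_right_comm]; exact h1 _ _
    simp only [bilinear, Int.fract_add_natCast, Int.floor_add_natCast, h1, h2]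
  simp only [avg]
  congr 1
  refine Finset.sum_congr rfl fun y _ => ?_
  rw [← key (((z.1 : ℝ), (z.2 : ℝ)) + y)]
  congr 2
  ext <;> simp [add_right_comm]

/-- `v'` is obtained from `v` by filling the row `m` consistently with the averaging. -/
def FillsRow (S : Finset (ℝ × ℝ)) (ω : ℝ × ℝ → ℝ) (m : ℤ) (v v' : ℤ × ℤ → ℝ) : Prop :=
  (∀ z : ℤ × ℤ, z.2 ≠ m → v' z = v z) ∧ ∀ z : ℤ × ℤ, z.2 = m → v' z = avg S ω v' z

/-- The difference of two fillings vanishes below row `m` and equals its own average on it, so the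
maximum principle applies with either sign. Periodicity serves to bound the row. -/
theorem Admissible.fillsRow_unique (hS : Admissible r S ω) {N : ℕ} (hN : 0 < N) {m : ℤ}
    {v v₁ v₂ : ℤ × ℤ → ℝ} (h₁ : FillsRow S ω m v v₁) (h₂ : FillsRow S ω m v v₂)
    (p₁ : HPeriodic N v₁) (p₂ : HPeriodic N v₂) : v₁ = v₂ := by
  have key : ∀ {v₁ v₂ : ℤ × ℤ → ℝ}, FillsRow S ω m v v₁ → FillsRow S ω m v v₂ → HPeriodic N v₁ →
      HPeriodic N v₂ → ∀ z, v₂ z ≤ v₁ z := by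
    intro v₁ v₂ h₁ h₂ p₁ p₂ z
    by_cases hz : z.2 = m
    · obtain ⟨C₁, hC₁⟩ := p₁.bounded hN m
      obtain ⟨C₂, hC₂⟩ := p₂.bounded hN m
      have := hS.row_nonneg (F := fun z => v₁ z - v₂ z) (m := m)
        (fun ζ _ h => by rw [h₁.1 ζ h.ne, h₂.1 ζ h.ne, sub_self])
        ⟨C₁ + C₂, fun ζ hζ => by
          have a₁ := abs_le.1 (hC₁ ζ hζ)
          have a₂ := abs_le.1 (hC₂ ζ hζ)
          linarith⟩
        (fun ζ hζ => by rw [avg_sub, ← h₁.2 ζ hζ, ← h₂.2 ζ hζ]) z hz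
      linarith
    · rw [h₁.1 z hz, h₂.1 z hz]
  exact funext fun z => le_antisymm (key h₂ h₁ p₂ p₁ z) (key h₁ h₂ p₁ p₂ z)

/-- A periodic row is a function on `ZMod N`. Changing it changes its averages by at most `q < 1`
times the sup distance, so the contraction principle solves the row equation. -/
theorem Admissible.exists_fillsRow (hS : Admissible r S ω) {N : ℕ} (hN : 0 < N) (m : ℤ)
    {v : ℤ × ℤ → ℝ} (hv : HPeriodic N v) : ∃ v', FillsRow S ω m v v' ∧ HPeriodic N v' := by
  have : NeZero N := ⟨hN.ne'⟩
  set fill : (ZMod N → ℝ) → ℤ × ℤ → ℝ := fun f z => if z.2 = m then f z.1 else v z with hfill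
  have hper : ∀ f, HPeriodic N (fill f) := by
    intro f z
    simp only [hfill]
    split_ifs
    · simp
    · exact hv z
  set T : (ZMod N → ℝ) → (ZMod N → ℝ) := fun f i => avg S ω (fill f) ((i.val : ℤ), m) with hT
  obtain ⟨q0, q1⟩ := hS.contraction_factor
  set q := 1 + (barycenter S ω).2 / (r + 1) with hq
  have hlip : LipschitzWith q.toNNReal T := by
    refine LipschitzWith.of_dist_le_mul fun f f' => ?_
    rw [Real.coe_toNNReal q q0, dist_pi_le_iff (mul_nonneg q0 dist_nonneg)]
    intro i
    have key : ∀ f f' : ZMod N → ℝ, T f' i - T f i ≤ q * dist f f' := by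
      intro f f'
      have := hS.le_avg_of_row (F := fun ζ => fill f ζ - fill f' ζ) (c := dist f f')
        (z := ((i.val : ℤ), m)) dist_nonneg
        (fun ζ _ h => by simp only [hfill, if_neg h.ne, sub_self, le_refl])
        (fun ζ h => by
          have h' : ζ.2 = m := h
          simp only [hfill, if_pos h']
          have h3 := dist_le_pi_dist f f' ζ.1
          rw [Real.dist_eq] at h3
          exact (abs_le.1 h3).1)
      rw [avg_sub] at this
      simp only [hT]
      linarith
    rw [Real.dist_eq, abs_le]
    have k1 := key f f'
    have k2 := key f' f
    rw [dist_comm f' f] at k2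
    exact ⟨by linarith, k2⟩
  have hcon : ContractingWith q.toNNReal T := ⟨Real.toNNReal_lt_one.2 q1, hlip⟩
  set f := ContractingWith.fixedPoint T hcon
  have hf : T f = f := hcon.fixedPoint_isFixedPt
  refine ⟨fill f, ⟨fun z hz => by simp only [hfill, if_neg hz], fun z hz => ?_⟩, hper f⟩
  have h1 : fill f z = f z.1 := by simp only [hfill, if_pos hz]
  have h2 : f z.1 = avg S ω (fill f) (((z.1 : ZMod N).val : ℤ), z.2) := by
    rw [hz]; exact (congrFun hf z.1).symm
  rw [h1, h2]
  exact (avg_hperiodic (hper f)).eq_of_modEq z.2 (by simp)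

/-! ### The algorithm as an iteration of averagings -/

theorem readable_eq {N k : ℕ} (hk : k ≤ N) : readable N k = {p : ℝ × ℝ | p.2 ≤ k} := by
  ext p
  simp only [readable, unfilledRegion, unfilledPixels, Set.mem_sdiff, mem_ofPred_eq, not_and, not_exists]
  constructor
  · rintro ⟨h1, h2⟩
    by_contra hlt
    push Not at hlt
    have a1 := Int.le_ceil p.2
    have a2 := Int.ceil_lt_add_one p.2
    have b1 := Int.floor_le p.1
    have b2 := Int.lt_floor_add_one p.1
    -- Rounding the height upwards gives an unfilled pixel less than one away; it stays in the image
    -- because `p.2 ≤ N` with `N` an integer.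
    refine h2 h1 (⌊p.1⌋, ⌈p.2⌉) ⟨?_, ?_⟩ ?_ ?_
    · exact Int.lt_ceil.2 (by exact_mod_cast hlt)
    · exact Int.ceil_le.2 (by exact_mod_cast h1)
    · rw [abs_lt]; constructor <;> linarith
    · rw [abs_lt]; constructor <;> linarith
  · intro h
    have hkN : (k : ℝ) ≤ N := by exact_mod_cast hk
    refine ⟨h.trans hkN, fun _ z hz _ hlt => ?_⟩
    have : (k : ℝ) + 1 ≤ z.2 := by exact_mod_cast hz.1
    linarith [(abs_lt.1 hlt).2]

theorem stencil_subset (method : Method) (A : Finset (ℝ × ℝ)) {y : ℝ × ℝ}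
    (hy : y ∈ stencil method A) : y ∈ A ∧ y.2 ≤ 0 := by
  classical
  cases method <;> simp only [stencil, Finset.mem_filter] at hy
  · exact ⟨hy.1, by linarith [hy.2.2]⟩
  · exact ⟨hy.1, hy.2.2⟩

theorem update_direct {N k : ℕ} (hk : k ≤ N) (r : ℝ) (A : Finset (ℝ × ℝ)) (w : ℝ × ℝ → ℝ)
    (v : ℤ × ℤ → ℝ) {z : ℤ × ℤ} (hz : z.2 = k + 1) :
    update r A w (readable N k) v z = avg (stencil .direct A) (fun y => w (r⁻¹ • y)) v z := by
  classical
  have e : (A.filter fun y => y ≠ 0 ∧ ((z.1 : ℝ), (z.2 : ℝ)) + y ∈ readable N k) =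
      stencil .direct A := by
    simp only [stencil]
    refine Finset.filter_congr fun y _ => ?_
    rw [readable_eq hk, hz]
    simp only [mem_ofPred_eq, Prod.snd_add, Int.cast_add, Int.cast_natCast, Int.cast_one]
    refine and_congr_right fun _ => ⟨fun h => by linarith, fun h => by linarith⟩
  rw [← e]
  simp only [update, avg]

theorem update_semiImplicit {N k : ℕ} (hk : k ≤ N) (r : ℝ) (A : Finset (ℝ × ℝ)) (w : ℝ × ℝ → ℝ)
    (v : ℤ × ℤ → ℝ) {z : ℤ × ℤ} (hz : z.2 = k) :
    update r A w (readable N k) v z = avg (stencil .semiImplicit A) (fun y => w (r⁻¹ • y)) v z := by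
  classical
  have e : (A.filter fun y => y ≠ 0 ∧ ((z.1 : ℝ), (z.2 : ℝ)) + y ∈ readable N k) =
      stencil .semiImplicit A := by
    simp only [stencil]
    refine Finset.filter_congr fun y _ => ?_
    rw [readable_eq hk, hz]
    simp only [mem_ofPred_eq, Prod.snd_add, Int.cast_natCast]
    refine and_congr_right fun _ => ⟨fun h => by linarith, fun h => by linarith⟩
  rw [← e]
  simp only [update, avg]

/-- The direct form never reads the row that it fills. -/
theorem avg_direct_congr {A : Finset (ℝ × ℝ)} {ω : ℝ × ℝ → ℝ} {v v' : ℤ × ℤ → ℝ} {z : ℤ × ℤ}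
    (h : ∀ ζ : ℤ × ℤ, ζ.2 ≠ z.2 → v ζ = v' ζ) :
    avg (stencil .direct A) ω v z = avg (stencil .direct A) ω v' z := by
  classical
  simp only [avg]
  congr 1
  refine Finset.sum_congr rfl fun y hy => ?_
  congr 1
  have hy2 : y.2 ≤ -1 := by
    simp only [stencil, Finset.mem_filter] at hy
    exact hy.2.2
  have key : ∀ ζ : ℤ × ℤ, |(ζ.2 : ℝ) - (((z.1 : ℝ), (z.2 : ℝ)) + y).2| < 1 → v ζ = v' ζ := by
    intro ζ h2
    refine h ζ fun h3 => ?_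
    simp only [Prod.snd_add, h3] at h2
    linarith [(abs_lt.1 h2).2]
  exact le_antisymm (bilinear_le_bilinear fun ζ _ h2 => (key ζ h2).le)
    (bilinear_le_bilinear fun ζ _ h2 => (key ζ h2).ge)

/-- The direct form reads the old image, but its stencil avoids the row being filled, where alone
the old and new images differ. Both forms thus become the same implicit row equation, with different
stencils. -/
theorem step_iff_fillsRow (method : Method) {N k : ℕ} (hk : k < N) (r : ℝ) (A : Finset (ℝ × ℝ))
    (w : ℝ × ℝ → ℝ) (v v' : ℤ × ℤ → ℝ) :
    Step method N r A w k v v' ↔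
      FillsRow (stencil method A) (fun y => w (r⁻¹ • y)) (k + 1) v v' := by
  refine and_congr_right fun hrow => ?_
  refine forall_congr' fun z => forall_congr' fun hz => ?_
  cases method
  · simp only
    rw [update_direct hk.le r A w v hz, avg_direct_congr fun ζ hζ => (hrow ζ (hz ▸ hζ)).symm]
  · simp only
    rw [update_semiImplicit (k := k + 1) hk r A w v' (by rw [hz]; push_cast; rfl)]

theorem admissible_stencil (method : Method) {r : ℝ} (hr : 1 ≤ r) {A : Finset (ℝ × ℝ)}
    (hA : ∀ y ∈ A, y.1 ^ 2 + y.2 ^ 2 ≤ r ^ 2) {w : ℝ × ℝ → ℝ} (hw : ∀ y, 0 ≤ w y)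
    (hmass : 0 < totalMass method r A w) (hg : (centerOfMass method r A w).2 ≠ 0) :
    Admissible r (stencil method A) (fun y => w (r⁻¹ • y)) where
  one_le := hr
  nonneg y := hw _
  mass_pos := hmass
  abs_fst_le y hy := abs_le_of_sq_le_sq
    (by nlinarith [hA y (stencil_subset method A hy).1, sq_nonneg y.2]) (by linarith)
  le_snd y hy := (abs_le.1 (abs_le_of_sq_le_sq (a := y.2) (b := r)
    (by nlinarith [hA y (stencil_subset method A hy).1, sq_nonneg y.1]) (by linarith))).1
  snd_nonpos y hy := (stencil_subset method A hy).2
  drift := by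
    refine lt_of_le_of_ne ?_ hg
    rw [barycenter_snd]
    exact div_nonpos_of_nonpos_of_nonneg (Finset.sum_nonpos fun y hy =>
      mul_nonpos_of_nonneg_of_nonpos (hw _) (stencil_subset method A hy).2) hmass.le

theorem damagedImage_hperiodic {N : ℕ} (hN : 0 < N) {u₀ : ℝ × ℝ → ℝ}
    (hper : ∀ a b : ℝ, u₀ (a + 1, b) = u₀ (a, b)) : HPeriodic N (damagedImage N u₀) := by
  intro z
  have hN' : (N : ℝ) ≠ 0 := by exact_mod_cast hN.ne'
  simp only [damagedImage]
  split_ifs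
  · rw [← hper ((z.1 : ℝ) / N)]; congr 2; push_cast; field_simp
  · rfl

/-- Existence and uniqueness of the inpainted image. -/
theorem existsUnique_isInpainted (method : Method) {N : ℕ} (hN : 0 < N) {r : ℝ}
    {A : Finset (ℝ × ℝ)} {w : ℝ × ℝ → ℝ}
    (hS : Admissible r (stencil method A) (fun y => w (r⁻¹ • y))) {u₀ : ℝ × ℝ → ℝ}
    (hper : ∀ a b : ℝ, u₀ (a + 1, b) = u₀ (a, b)) :
    ∃! u : ℤ × ℤ → ℝ, IsInpainted method N r A w u₀ u := by
  have hex : ∀ (k : ℕ) (v : {v : ℤ × ℤ → ℝ // HPeriodic N v}),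
      ∃ v' : {v : ℤ × ℤ → ℝ // HPeriodic N v},
        FillsRow (stencil method A) (fun y => w (r⁻¹ • y)) (k + 1) v.1 v'.1 := by
    intro k v
    obtain ⟨v', h1, h2⟩ := hS.exists_fillsRow hN (k + 1) v.2
    exact ⟨⟨v', h2⟩, h1⟩
  choose next hnext using hex
  let V : ℕ → {v : ℤ × ℤ → ℝ // HPeriodic N v} :=
    Nat.rec ⟨damagedImage N u₀, damagedImage_hperiodic hN hper⟩ fun k v => next k v
  refine ⟨(V N).1, ⟨fun k => (V k).1, rfl, fun k _ => (V k).2,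
    fun k hk => (step_iff_fillsRow method hk r A w _ _).2 (hnext k (V k)), rfl⟩, ?_⟩
  rintro u ⟨v, hv0, hvper, hvstep, rfl⟩
  have key : ∀ k ≤ N, v k = (V k).1 := by
    intro k
    induction k with
    | zero => intro _; exact hv0
    | succ k ih =>
      intro hk
      have h1 := (step_iff_fillsRow method (by omega) r A w _ _).1 (hvstep k (by omega))
      rw [ih (by omega)] at h1
      exact hS.fillsRow_unique hN h1 (hnext k (V k)) (hvper (k + 1) hk) (V (k + 1)).2
  exact key N le_rfl

/-- The inpainted image is a periodic discrete solution that extends the data. -/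
theorem IsInpainted.properties {method : Method} {N : ℕ} {r : ℝ}
    {A : Finset (ℝ × ℝ)} {w : ℝ × ℝ → ℝ}
    (hS : Admissible r (stencil method A) (fun y => w (r⁻¹ • y))) {u₀ : ℝ × ℝ → ℝ}
    {u : ℤ × ℤ → ℝ} (hu : IsInpainted method N r A w u₀ u) :
    HPeriodic N u ∧ (∀ z : ℤ × ℤ, z.2 ≤ 0 → u z = u₀ ((z.1 : ℝ) / N, (z.2 : ℝ) / N)) ∧
      ∀ z : ℤ × ℤ, 1 ≤ z.2 → z.2 ≤ N →
        avg (stencil method A) (fun y => w (r⁻¹ • y)) u z = u z := by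
  obtain ⟨v, hv0, hvper, hvstep, rfl⟩ := hu
  have hfill := fun k hk => (step_iff_fillsRow method hk r A w _ _).1 (hvstep k hk)
  -- A filled row is never changed again, so the equation it satisfied when it was filled persists
  -- in the final image.
  have stable : ∀ k n : ℕ, k ≤ n → n ≤ N → ∀ z : ℤ × ℤ, z.2 ≤ k → v n z = v k z := by
    intro k n hkn
    induction n, hkn using Nat.le_induction with
    | base => intros; rfl
    | succ n hkn ih =>
      intro hn z hz
      rw [(hfill n (by omega)).1 z (by omega)]
      exact ih (by omega) z hz
  refine ⟨hvper N le_rfl, fun z hz => ?_, fun z h1 h2 => ?_⟩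
  · rw [stable 0 N (Nat.zero_le _) le_rfl z (by simpa using hz), hv0]
    simp [damagedImage, hz]
  · obtain ⟨k, hk⟩ : ∃ k : ℕ, z.2 = k + 1 := ⟨(z.2 - 1).toNat, by omega⟩
    have hkN : k < N := by omega
    rw [stable (k + 1) N hkN le_rfl z (by push_cast; omega), (hfill k hkN).2 z hk]
    exact hS.avg_congr fun ζ hζ => stable (k + 1) N hkN le_rfl ζ (by push_cast; omega)

end wellposed

/-! ### First order Taylor expansion in Hölder classes -/

section taylor

variable {S : Set (ℝ × ℝ)} {u : ℝ × ℝ → ℝ}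

/-- The linear term of the Taylor expansion of order `s ≤ 2`. -/
noncomputable def taylorGrad (s : ℝ) (S : Set (ℝ × ℝ)) (u : ℝ × ℝ → ℝ) (p : ℝ × ℝ) :
    (ℝ × ℝ) →L[ℝ] ℝ :=
  open Classical in if 1 < s then fderivWithin ℝ u S p else 0

theorem norm_fderivWithin_sub_le (hS : UniqueDiffOn ℝ S) {p q : ℝ × ℝ} (hp : p ∈ S) (hq : q ∈ S) :
    ‖fderivWithin ℝ u S p - fderivWithin ℝ u S q‖ ≤
      ‖iteratedFDerivWithin ℝ 1 u S p - iteratedFDerivWithin ℝ 1 u S q‖ := by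
  refine ContinuousLinearMap.opNorm_le_bound _ (norm_nonneg _) fun v => ?_
  have := (iteratedFDerivWithin ℝ 1 u S p - iteratedFDerivWithin ℝ 1 u S q).le_opNorm fun _ => v
  simpa [iteratedFDerivWithin_one_apply (hS p hp), iteratedFDerivWithin_one_apply (hS q hq)]
    using this

theorem norm_fderivWithin_le (hS : UniqueDiffOn ℝ S) {p : ℝ × ℝ} (hp : p ∈ S) :
    ‖fderivWithin ℝ u S p‖ ≤ ‖iteratedFDerivWithin ℝ 1 u S p‖ := by
  refine ContinuousLinearMap.opNorm_le_bound _ (norm_nonneg _) fun v => ?_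
  have := (iteratedFDerivWithin ℝ 1 u S p).le_opNorm fun _ => v
  simpa [iteratedFDerivWithin_one_apply (hS p hp)] using this

/-- Taylor expansion for functions with Hölder continuous derivative. -/
theorem abs_taylor_le (hS : Convex ℝ S) (hd : DifferentiableOn ℝ u S) {C β : ℝ} (hC : 0 ≤ C)
    (hβ : 0 ≤ β)
    (hH : ∀ p ∈ S, ∀ q ∈ S, ‖fderivWithin ℝ u S p - fderivWithin ℝ u S q‖ ≤ C * ‖p - q‖ ^ β)
    {p q : ℝ × ℝ} (hp : p ∈ S) (hq : q ∈ S) :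
    |u q - u p - fderivWithin ℝ u S p (q - p)| ≤ C * ‖q - p‖ ^ (1 + β) := by
  have hseg : segment ℝ p q ⊆ S := hS.segment_subset hp hq
  -- Mean value inequality on the segment: the derivative there differs from the one at `p` by at
  -- most `C ‖q - p‖ ^ β`.
  have key := (convex_segment p q).norm_image_sub_le_of_norm_hasFDerivWithin_le'
    (f := u) (f' := fderivWithin ℝ u S) (φ := fderivWithin ℝ u S p) (C := C * ‖q - p‖ ^ β)
    (fun x hx => ((hd x (hseg hx)).hasFDerivWithinAt).mono hseg)
    (fun x hx => (hH x (hseg hx) p hp).trans (by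
      gcongr
      obtain ⟨t, ht, rfl⟩ := (segment_eq_image' ℝ p q ▸ hx)
      simp only [add_sub_cancel_left, norm_smul, Real.norm_eq_abs, abs_of_nonneg ht.1]
      exact mul_le_of_le_one_left (norm_nonneg _) ht.2))
    (left_mem_segment ℝ p q) (right_mem_segment ℝ p q)
  rw [Real.norm_eq_abs] at key
  refine key.trans (le_of_eq ?_)
  rw [mul_assoc]
  congr 1
  rcases (norm_nonneg (q - p)).eq_or_lt with h | h
  · rw [← h, mul_zero, Real.zero_rpow (by linarith)]
  · rw [Real.rpow_add h, Real.rpow_one, mul_comm]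

theorem MemSobolevInf.differentiableOn {s : ℝ} (h : MemSobolevInf s S u) (hs : 1 < s) :
    DifferentiableOn ℝ u S := by
  obtain ⟨k, α, hk, -, hα1, hcd, -⟩ := h.2 (by linarith)
  have : k ≠ 0 := by rintro rfl; simp at hk; linarith
  exact hcd.differentiableOn (by exact_mod_cast this)

/-- Taylor expansion of order `min s 2` for functions in `W^{s,∞}`. -/
theorem MemSobolevInf.taylor {s : ℝ} (h : MemSobolevInf s S u) (hs : 0 ≤ s) (hS : Convex ℝ S)
    (hi : (interior S).Nonempty) :
    ∃ C, 0 ≤ C ∧ ∀ p ∈ S, ‖taylorGrad s S u p‖ ≤ C ∧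
      ∀ q ∈ S, |u q - u p - taylorGrad s S u p (q - p)| ≤ C * ‖q - p‖ ^ (min s 2) := by
  have hU : UniqueDiffOn ℝ S := uniqueDiffOn_convex hS hi
  rcases hs.eq_or_lt with rfl | hs0
  · obtain ⟨C, hC⟩ := h.1
    refine ⟨2 * |C|, by positivity, fun p hp => ⟨?_, fun q hq => ?_⟩⟩
    · have : ¬ (1 : ℝ) < 0 := by norm_num
      simp only [taylorGrad, if_neg this, norm_zero]
      positivity
    have h1 := (hC p hp).trans (le_abs_self C)
    have h2 := (hC q hq).trans (le_abs_self C)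
    have : ¬ (1 : ℝ) < 0 := by norm_num
    simp only [taylorGrad, if_neg this, zero_apply, sub_zero,
      min_eq_left (by norm_num : (0 : ℝ) ≤ 2), Real.rpow_zero]
    rw [abs_le] at h1 h2 ⊢
    constructor <;> linarith
  obtain ⟨k, α, hk, hα0, hα1, hcd, C, hCb, hCh⟩ := h.2 hs0
  -- For `k = 0`, that is `s ≤ 1`, the Hölder bound is already the expansion, with no linear term.
  rcases Nat.eq_zero_or_pos k with rfl | hkpos
  · have hsα : s = α := by simpa using hk
    have : ¬ 1 < s := by rw [hsα]; linarith
    refine ⟨|C|, abs_nonneg _, fun p hp => ⟨by simp [taylorGrad, this], fun q hq => ?_⟩⟩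
    simp only [taylorGrad, if_neg this, zero_apply, sub_zero]
    rw [min_eq_left (by linarith), hsα]
    have h1 := (iteratedFDerivWithin ℝ 0 u S q - iteratedFDerivWithin ℝ 0 u S p).le_opNorm 0
    simp only [sub_apply, iteratedFDerivWithin_zero_apply,
      Finset.univ_eq_empty, Finset.prod_empty, mul_one, Real.norm_eq_abs] at h1
    refine h1.trans ((hCh q hq p hp).trans ?_)
    gcongr
    exact le_abs_self C
  · have hs1 : 1 < s := by
      have : (1 : ℝ) ≤ k := by exact_mod_cast hkpos
      linarith
    have hd := h.differentiableOn hs1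
    -- The first derivative is Hölder with exponent `α` if `k = 1`. If `k ≥ 2`, bounded second
    -- derivatives make it Lipschitz on the convex set, and the order of the expansion stops at two.
    have hH : ∃ β, 0 ≤ β ∧ min s 2 = 1 + β ∧ ∀ p ∈ S, ∀ q ∈ S,
        ‖fderivWithin ℝ u S p - fderivWithin ℝ u S q‖ ≤ |C| * ‖p - q‖ ^ β := by
      rcases (Nat.succ_le_of_lt hkpos).eq_or_lt with hk1 | hk2
      · have hk1 : k = 1 := hk1.symm
        subst hk1
        refine ⟨α, hα0.le, ?_, fun p hp q hq => ?_⟩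
        · rw [hk]; push_cast; exact min_eq_left (by linarith)
        · refine (norm_fderivWithin_sub_le hU hp hq).trans ((hCh p hp q hq).trans ?_)
          gcongr
          exact le_abs_self C
      · have hk2 : 2 ≤ k := hk2
        refine ⟨1, zero_le_one, ?_, fun p hp q hq => ?_⟩
        · have : (2 : ℝ) ≤ k := by exact_mod_cast hk2
          rw [min_eq_right (by linarith)]; norm_num
        · refine (norm_fderivWithin_sub_le hU hp hq).trans ?_
          rw [Real.rpow_one]
          refine hS.norm_image_sub_le_of_norm_fderivWithin_le (f := iteratedFDerivWithin ℝ 1 u S)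
            (hcd.differentiableOn_iteratedFDerivWithin (by exact_mod_cast hk2) hU)
            (fun x hx => ?_) hq hp
          rw [norm_fderivWithin_iteratedFDerivWithin]
          exact (hCb 2 hk2 x hx).trans (le_abs_self C)
    obtain ⟨β, hβ0, hβ, hH⟩ := hH
    refine ⟨|C|, abs_nonneg _, fun p hp => ?_⟩
    simp only [taylorGrad, if_pos hs1]
    refine ⟨(norm_fderivWithin_le hU hp).trans ((hCb 1 hkpos p hp).trans (le_abs_self C)),
      fun q hq => ?_⟩
    rw [hβ]
    exact abs_taylor_le hS hd (abs_nonneg _) hβ0 hH hp hq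

end taylor

/-! ### The regions between the triangles -/

section regions

variable {M : ℕ} [NeZero M] {δ L : ℝ} {x : Fin M → ℝ}

theorem undamaged_convex (δ : ℝ) : Convex ℝ (undamaged δ) := by
  have : undamaged δ = Prod.snd ⁻¹' Ioc (-δ) 0 := rfl
  rw [this]
  exact (convex_Ioc (-δ) 0).linear_preimage (LinearMap.snd ℝ ℝ ℝ)

theorem undamaged_interior (hδ : 0 < δ) : (interior (undamaged δ)).Nonempty := by
  refine ⟨(0, -δ / 2), mem_interior.2 ⟨Prod.snd ⁻¹' Ioo (-δ) 0, ?_, ?_, ?_⟩⟩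
  · exact fun p hp => ⟨hp.1, hp.2.le⟩
  · exact isOpen_Ioo.preimage continuous_snd
  · constructor <;> simp only <;> linarith

/-- Between the tips the absolute values have a fixed sign, so the region is an intersection of
half-planes. Its convexity, needed for Taylor expansion along segments, is read off from this form.
-/
theorem mem_between_iff {i : Fin M} {p : ℝ × ℝ} : p ∈ between δ L x i ↔
    (-δ < p.2 ∧ p.2 ≤ 0) ∧ (leftTip x i < p.1 ∧ p.1 < x i) ∧
      -(L * (p.1 - leftTip x i)) < p.2 ∧ -(L * (x i - p.1)) < p.2 := by
  simp only [between, undamaged, triangle, Set.mem_sdiff, mem_union, mem_ofPred_eq, not_or]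
  constructor
  · rintro ⟨⟨h1, h2, h3⟩, h4, h5⟩
    refine ⟨h1, ⟨h2, h3⟩, ?_, ?_⟩
    · by_contra hcon
      refine h4 ⟨h1.1.le, h1.2, ?_⟩
      rw [abs_of_neg (by linarith)]; linarith
    · by_contra hcon
      refine h5 ⟨h1.1.le, h1.2, ?_⟩
      rw [abs_of_pos (by linarith)]; linarith
  · rintro ⟨h1, ⟨h2, h3⟩, h4, h5⟩
    refine ⟨⟨h1, h2, h3⟩, fun h => ?_, fun h => ?_⟩
    · rw [abs_of_neg (by linarith)] at h; linarith [h.2.2]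
    · rw [abs_of_pos (by linarith)] at h; linarith [h.2.2]

theorem between_convex (i : Fin M) : Convex ℝ (between δ L x i) := by
  intro p hp q hq a b ha hb hab
  rw [mem_between_iff] at *
  obtain ⟨⟨p1, p2⟩, ⟨p3, p4⟩, p5, p6⟩ := hp
  obtain ⟨⟨q1, q2⟩, ⟨q3, q4⟩, q5, q6⟩ := hq
  have key : ∀ {s t c : ℝ}, c < s → c < t → c < a * s + b * t := by
    intro s t c hs ht
    have : c = a * c + b * c := by rw [← add_mul, hab, one_mul]
    rcases ha.eq_or_lt with rfl | ha
    · have : b = 1 := by linarith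
      rw [this]; linarith
    · have h1 := mul_lt_mul_of_pos_left hs ha
      have h2 := mul_le_mul_of_nonneg_left ht.le hb
      linarith
  simp only [Prod.fst_add, Prod.snd_add, Prod.smul_fst, Prod.smul_snd, smul_eq_mul]
  refine ⟨⟨key p1 q1, by nlinarith⟩, ⟨key p3 q3, ?_⟩, ?_, ?_⟩
  · have := key (neg_lt_neg p4) (neg_lt_neg q4); linarith
  · have := key (c := 0) (s := p.2 + L * (p.1 - leftTip x i)) (t := q.2 + L * (q.1 - leftTip x i))
      (by linarith) (by linarith)
    linear_combination this - (L * leftTip x i) * hab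
  · have := key (c := 0) (s := p.2 + L * (x i - p.1)) (t := q.2 + L * (x i - q.1))
      (by linarith) (by linarith)
    linear_combination this + (L * x i) * hab

theorem fin_sub_one_lt {i : Fin M} (h : i ≠ 0) : i - 1 < i := by
  obtain ⟨n, rfl⟩ := Nat.exists_eq_succ_of_ne_zero (NeZero.ne M)
  exact Fin.sub_one_lt_iff.2 (Fin.pos_iff_ne_zero.2 h)

theorem leftTip_lt (hx : StrictMono x) (hx01 : ∀ i, x i ∈ Ioc (0 : ℝ) 1) (i : Fin M) :
    leftTip x i < x i := by
  unfold leftTip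
  split_ifs with h
  · linarith [(hx01 (i - 1)).2, (hx01 i).1]
  · exact hx (fin_sub_one_lt h)

theorem leftTip_eq (i : Fin M) : ∃ (j : Fin M) (n : ℤ), leftTip x i = x j + n := by
  unfold leftTip
  split_ifs
  · exact ⟨i - 1, -1, by push_cast; ring⟩
  · exact ⟨i - 1, 0, by simp⟩

theorem between_interior (hδ : 0 < δ) (hL : 0 < L) (hx : StrictMono x)
    (hx01 : ∀ i, x i ∈ Ioc (0 : ℝ) 1) (i : Fin M) : (interior (between δ L x i)).Nonempty := by
  have hlt := leftTip_lt hx hx01 i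
  set l := leftTip x i with hl
  set m := min δ (L * ((x i - l) / 2)) with hm
  have hm0 : 0 < m := lt_min hδ (by have : 0 < x i - l := by linarith
                                    positivity)
  have hmδ : m ≤ δ := min_le_left _ _
  have hmL : m ≤ L * ((x i - l) / 2) := min_le_right _ _
  refine ⟨((l + x i) / 2, -m / 2), mem_interior.2 ⟨{p | (-δ < p.2 ∧ p.2 < 0) ∧
    (l < p.1 ∧ p.1 < x i) ∧ -(L * (p.1 - l)) < p.2 ∧ -(L * (x i - p.1)) < p.2},
    fun p hp => mem_between_iff.2 ⟨⟨hp.1.1, hp.1.2.le⟩, hp.2⟩, ?_, ?_⟩⟩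
  · exact ((isOpen_lt (by fun_prop) (by fun_prop)).and (isOpen_lt (by fun_prop) (by fun_prop))).and
      (((isOpen_lt (by fun_prop) (by fun_prop)).and (isOpen_lt (by fun_prop) (by fun_prop))).and
      ((isOpen_lt (by fun_prop) (by fun_prop)).and (isOpen_lt (by fun_prop) (by fun_prop))))
  · refine ⟨⟨?_, ?_⟩, ⟨?_, ?_⟩, ?_, ?_⟩ <;> simp only
    · linarith
    · linarith
    · linarith
    · linarith
    · have : L * ((l + x i) / 2 - l) = L * ((x i - l) / 2) := by ring
      rw [this]; linarith
    · have : L * (x i - (l + x i) / 2) = L * ((x i - l) / 2) := by ring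
      rw [this]; linarith

/-- Every real number is a tip or lies between two neighbouring tips, up to integers. -/
theorem exists_tip_or_between (hx01 : ∀ i, x i ∈ Ioc (0 : ℝ) 1) (a : ℝ) :
    (∃ (i : Fin M) (n : ℤ), a = x i + n) ∨
      ∃ (i : Fin M) (n : ℤ), leftTip x i + n < a ∧ a < x i + n := by
  have c1 := Int.le_ceil a
  have c2 := Int.ceil_lt_add_one a
  -- Subtracting `⌈a⌉ - 1` moves `a` into `(0,1]`. The first tip at or to the right of it, if any,
  -- is the right end; otherwise the right end is the first tip of the next period.
  by_cases hex : ∃ i, a - (⌈a⌉ - 1 : ℤ) ≤ x i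
  · obtain ⟨i, hi, hmin⟩ := WellFounded.has_min (wellFounded_lt (α := Fin M))
      {i | a - (⌈a⌉ - 1 : ℤ) ≤ x i} hex
    rcases (show a - (⌈a⌉ - 1 : ℤ) ≤ x i from hi).eq_or_lt with h | h
    · exact Or.inl ⟨i, ⌈a⌉ - 1, by linarith⟩
    · refine Or.inr ⟨i, ⌈a⌉ - 1, ?_, by linarith⟩
      unfold leftTip
      split_ifs with h0
      · push_cast; linarith [(hx01 (i - 1)).2]
      · have := hmin (i - 1)
        have hlt : i - 1 < i := fin_sub_one_lt h0
        by_contra hcon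
        exact this (show a - (⌈a⌉ - 1 : ℤ) ≤ x (i - 1) by linarith) hlt
  · push Not at hex
    refine Or.inr ⟨0, ⌈a⌉, ?_, ?_⟩
    · have := hex (0 - 1)
      simp only [leftTip, if_true]
      push_cast at this
      linarith
    · linarith [(hx01 0).1]

end regions

/-! ### Bounds for the boundary data -/

/-- Powers of the scaled distance are absorbed into the exponential weight, at the cost of a
constant independent of `ε`. -/
theorem exists_rpow_le_mul_exp {κ b t : ℝ} (hκ : 0 < κ) (hb : 0 ≤ b) (ht : 0 ≤ t) :
    ∃ C, 0 < C ∧ ∀ τ : ℝ, 0 ≤ τ → (τ + b) ^ t ≤ C * Real.exp (κ * τ) := by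
  set n := ⌈t⌉₊ with hn
  refine ⟨n.factorial / κ ^ n * Real.exp (κ * (1 + b)), by positivity, fun τ hτ => ?_⟩
  have h1 : (τ + b) ^ t ≤ (1 + b + τ) ^ n := by
    calc (τ + b) ^ t ≤ (1 + b + τ) ^ t :=
          Real.rpow_le_rpow (by positivity) (by linarith) ht
      _ ≤ (1 + b + τ) ^ (n : ℝ) :=
          Real.rpow_le_rpow_of_exponent_le (by linarith) (Nat.le_ceil t)
      _ = _ := Real.rpow_natCast _ _
  have h2 := Real.pow_div_factorial_le_exp (κ * (1 + b + τ)) (by positivity) n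
  have h3 : Real.exp (κ * (1 + b + τ)) = Real.exp (κ * (1 + b)) * Real.exp (κ * τ) := by
    rw [← Real.exp_add]; congr 1; ring
  rw [mul_pow, h3, div_le_iff₀ (by positivity)] at h2
  refine h1.trans ?_
  rw [div_mul_eq_mul_div, div_mul_eq_mul_div, le_div_iff₀ (by positivity)]
  linarith

theorem rpow_le_mul_rpow {ε δ a b : ℝ} (hε : 0 < ε) (hεδ : ε ≤ δ) (hab : b ≤ a) :
    ε ^ a ≤ δ ^ (a - b) * ε ^ b := by
  calc ε ^ a = ε ^ (a - b) * ε ^ b := by rw [← Real.rpow_add hε]; congr 1; ring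
    _ ≤ _ := by gcongr

/-- A Taylor bound, rewritten in terms of the coordinate that is constant along the
characteristics. -/
theorem exists_taylor_le_exp {δ Λ κ t : ℝ} (hδ : 0 < δ) (hΛ : 1 ≤ Λ) (hκ : 0 < κ) (ht : 0 ≤ t)
    (ht2 : t ≤ 2) : ∃ C, 0 < C ∧ ∀ (B ε c a : ℝ) (u : ℝ × ℝ → ℝ) (G : (ℝ × ℝ) →L[ℝ] ℝ) (q : ℝ × ℝ),
      0 < ε → ε ≤ δ → |c| ≤ Λ → -ε < q.2 → q.2 ≤ 0 → 0 ≤ B → ‖G‖ ≤ B →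
      |u q - u (a, 0) - G (q - (a, 0))| ≤ B * ‖q - (a, 0)‖ ^ t →
      |u q - u (a, 0) - G (1, 0) * (q.1 - c * q.2 - a)| ≤
        C * B * ε ^ (t / 2) * Real.exp (κ * (|q.1 - c * q.2 - a| / √ε)) := by
  obtain ⟨C, hC, hCe⟩ := exists_rpow_le_mul_exp (κ := κ) (b := (1 + Λ) * √δ) hκ (by positivity) ht
  refine ⟨C + (1 + Λ) * δ ^ (1 - t / 2), by positivity, ?_⟩
  intro B ε c a u G q hε hεδ hc hq1 hq2 hB hG hT
  set τ := |q.1 - c * q.2 - a| / √ε with hτ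
  have hσ : 0 < √ε := Real.sqrt_pos.2 hε
  have hτ0 : 0 ≤ τ := by positivity
  have hτσ : |q.1 - c * q.2 - a| = √ε * τ := by rw [hτ]; field_simp
  have hεσ : ε ≤ √ε * √δ := by
    calc ε = √ε * √ε := (Real.mul_self_sqrt hε.le).symm
      _ ≤ _ := by gcongr
  have hq2' : |q.2| ≤ ε := by rw [abs_le]; constructor <;> linarith
  have hcq : |c * q.2| ≤ Λ * ε := by rw [abs_mul]; gcongr
  have hnorm : ‖q - (a, 0)‖ ≤ √ε * (τ + (1 + Λ) * √δ) := by
    have hb : (1 + Λ) * ε ≤ (1 + Λ) * (√ε * √δ) := by gcongr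
    rw [Prod.norm_def, max_le_iff]
    simp only [Prod.fst_sub, Prod.snd_sub, sub_zero, Real.norm_eq_abs]
    constructor
    · have : q.1 - a = (q.1 - c * q.2 - a) + c * q.2 := by ring
      rw [this]
      refine (abs_add_le _ _).trans ?_
      rw [hτσ]; linarith
    · have : 0 ≤ √ε * τ := by positivity
      nlinarith
  have h1 : ‖q - (a, 0)‖ ^ t ≤ ε ^ (t / 2) * (C * Real.exp (κ * τ)) := by
    calc ‖q - (a, 0)‖ ^ t ≤ (√ε * (τ + (1 + Λ) * √δ)) ^ t :=
          Real.rpow_le_rpow (norm_nonneg _) hnorm ht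
      _ = ε ^ (t / 2) * (τ + (1 + Λ) * √δ) ^ t := by
          rw [Real.mul_rpow hσ.le (by positivity), Real.sqrt_eq_rpow, ← Real.rpow_mul hε.le]
          congr 2; ring
      _ ≤ _ := by gcongr; exact hCe τ hτ0
  have h2 : ε ≤ δ ^ (1 - t / 2) * ε ^ (t / 2) := by
    have := rpow_le_mul_rpow (a := 1) (b := t / 2) hε hεδ (by linarith)
    rwa [Real.rpow_one] at this
  -- Keeping only the part of the linear term along `ℓ` leaves `G` on a vector of length `O(ε)`.
  -- This is dominated by `ε ^ (t / 2)` because `t ≤ 2`.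
  have h3 : G (q - (a, 0)) - G (1, 0) * (q.1 - c * q.2 - a) = G (c * q.2, q.2) := by
    have e1 : q - (a, 0) = (q.1 - c * q.2 - a) • ((1 : ℝ), (0 : ℝ)) + (c * q.2, q.2) := by
      ext <;> simp
      ring
    rw [e1, map_add, map_smul, smul_eq_mul]; ring
  have h4 : |G (c * q.2, q.2)| ≤ B * ((1 + Λ) * ε) := by
    rw [← Real.norm_eq_abs]
    refine (G.le_opNorm _).trans ?_
    gcongr
    rw [Prod.norm_def, max_le_iff]
    simp only [Real.norm_eq_abs]
    constructor <;> nlinarith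
  have h5 : 1 ≤ Real.exp (κ * τ) := Real.one_le_exp (by positivity)
  calc |u q - u (a, 0) - G (1, 0) * (q.1 - c * q.2 - a)|
      = |(u q - u (a, 0) - G (q - (a, 0))) + G (c * q.2, q.2)| := by
        rw [← h3]; congr 1; ring
    _ ≤ B * (ε ^ (t / 2) * (C * Real.exp (κ * τ))) +
        B * ((1 + Λ) * (δ ^ (1 - t / 2) * ε ^ (t / 2))) * Real.exp (κ * τ) := by
        refine (abs_add_le _ _).trans (add_le_add (hT.trans (by gcongr)) ?_)
        refine le_trans (h4.trans ?_) (le_mul_of_one_le_right (by positivity) h5)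
        gcongr
    _ = _ := by ring

/-- The distance to the nearest integer. -/
noncomputable def distInt (a : ℝ) : ℝ := |a - round a|

theorem distInt_nonneg (a : ℝ) : 0 ≤ distInt a := abs_nonneg _

/-- The boundary layer around the tips, with width `√ε`. -/
noncomputable def layer {M : ℕ} (x : Fin M → ℝ) (κ ε a : ℝ) : ℝ :=
  ∑ i, Real.exp (-(κ * (distInt (a - x i) / √ε)))

theorem layer_nonneg {M : ℕ} (x : Fin M → ℝ) (κ ε a : ℝ) : 0 ≤ layer x κ ε a :=
  Finset.sum_nonneg fun _ _ => (Real.exp_pos _).le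

theorem exp_le_layer {M : ℕ} (x : Fin M → ℝ) (κ ε a : ℝ) (i : Fin M) :
    Real.exp (-(κ * (distInt (a - x i) / √ε))) ≤ layer x κ ε a :=
  Finset.single_le_sum (f := fun i => Real.exp (-(κ * (distInt (a - x i) / √ε))))
    (fun _ _ => (Real.exp_pos _).le) (Finset.mem_univ i)

theorem map_sub_int_of_periodic {u₀ : ℝ × ℝ → ℝ} (hper : ∀ a b : ℝ, u₀ (a + 1, b) = u₀ (a, b))
    (n : ℤ) (a b : ℝ) : u₀ (a - n, b) = u₀ (a, b) := by
  have h : Function.Periodic (fun a => u₀ (a, b)) 1 := fun a => hper a b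
  simpa using h.sub_int_mul_eq n (x := a)

section boundary

variable {M : ℕ} [NeZero M] {δ L : ℝ} {x : Fin M → ℝ} {u₀ : ℝ × ℝ → ℝ}

/-- A point of the strip that lies in a different region than `(a, 0)` is at a distance from it
that is at least comparable to the distance from `a` to the closest tip. -/
theorem exists_tip_near {Λ ε c a : ℝ} (hL : 0 < L) (hε : 0 < ε) (hεδ : ε ≤ δ) (hc : |c| ≤ Λ)
    {i : Fin M} {n : ℤ} (h1 : leftTip x i + n < a) (h2 : a < x i + n) {q : ℝ × ℝ} (hq1 : -ε < q.2)
    (hq2 : q.2 ≤ 0) (hq : (q.1 - n, q.2) ∉ between δ L x i) :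
    ∃ j, distInt (a - x j) ≤ √ε * (|q.1 - c * q.2 - a| / √ε + (Λ + 1 / L) * √δ) := by
  by_contra! hcon
  apply hq
  have hσ : 0 < √ε := Real.sqrt_pos.2 hε
  have hΛ : 0 ≤ Λ := (abs_nonneg c).trans hc
  have hεσ : ε ≤ √ε * √δ := by
    calc ε = √ε * √ε := (Real.mul_self_sqrt hε.le).symm
      _ ≤ _ := by gcongr
  have hcq : |c * q.2| ≤ Λ * ε := by
    rw [abs_mul]; gcongr; rw [abs_le]; constructor <;> linarith
  have hD : |q.1 - a| + -q.2 / L ≤ √ε * (|q.1 - c * q.2 - a| / √ε + (Λ + 1 / L) * √δ) := by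
    have e1 : √ε * (|q.1 - c * q.2 - a| / √ε + (Λ + 1 / L) * √δ) =
        |q.1 - c * q.2 - a| + (Λ + 1 / L) * (√ε * √δ) := by field_simp
    have e2 : |q.1 - a| ≤ |q.1 - c * q.2 - a| + |c * q.2| := by
      have : q.1 - a = (q.1 - c * q.2 - a) + c * q.2 := by ring
      rw [this]; simpa using abs_add_le (q.1 - c * q.2 - a) (c * q.2)
    have e3 : (Λ + 1 / L) * ε ≤ (Λ + 1 / L) * (√ε * √δ) := by gcongr
    have e4 : -q.2 / L ≤ 1 / L * ε := by
      rw [one_div_mul_eq_div]; gcongr; linarith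
    rw [e1]; linarith
  -- By the negated claim all translates of all tips are farther from `a` than `|q.1 - a| + |q.2| /
  -- L`. For the two neighbouring tips this puts `q` between the sides of the triangles.
  have hd : ∀ (j : Fin M) (m : ℤ), |q.1 - a| + -q.2 / L < |a - (x j + m)| := by
    intro j m
    refine hD.trans_lt ((hcon j).trans_le ?_)
    have := round_le (a - x j) m
    simp only [distInt]
    rwa [← sub_sub]
  have hr := hd i n
  rw [abs_of_neg (a := a - (x i + n)) (by linarith)] at hr
  obtain ⟨j, m, hjm⟩ := leftTip_eq (x := x) i
  have hl := hd j (m + n)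
  have : x j + ((m + n : ℤ) : ℝ) = leftTip x i + n := by rw [hjm]; push_cast; ring
  rw [this, abs_of_pos (a := a - (leftTip x i + n)) (by linarith)] at hl
  have ha := abs_le.1 (le_refl |q.1 - a|)
  have hq2L : 0 ≤ -q.2 / L := div_nonneg (by linarith) hL.le
  have hl' : -q.2 / L < q.1 - n - leftTip x i := by linarith
  have hr' : -q.2 / L < x i - (q.1 - n) := by linarith
  rw [mem_between_iff]
  refine ⟨⟨by simp only; linarith, hq2⟩, ⟨by simp only; linarith, by simp only; linarith⟩, ?_, ?_⟩
  · rw [div_lt_iff₀ hL] at hl'; simp only; linarith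
  · rw [div_lt_iff₀ hL] at hr'; simp only; linarith

/-- The deviation of the boundary data from a suitable affine function of the coordinate that is
constant along the characteristics. -/
theorem exists_boundary_bound {s s' : ℝ} (hδ : 0 < δ) (hL : 0 < L) (hs : 0 < s) (hs' : 0 ≤ s')
    (hss' : s' ≤ s) (hx : StrictMono x) (hx01 : ∀ i, x i ∈ Ioc (0 : ℝ) 1)
    (hper : ∀ a b : ℝ, u₀ (a + 1, b) = u₀ (a, b)) (hglobal : MemSobolevInf s' (undamaged δ) u₀)
    (hlocal : ∀ i, MemSobolevInf s (between δ L x i) u₀) {Λ κ : ℝ} (hΛ : 1 ≤ Λ) (hκ : 0 < κ) :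
    ∃ C, 0 < C ∧ ∀ ε c a : ℝ, 0 < ε → ε ≤ δ → |c| ≤ Λ → ∃ β : ℝ, ∀ q : ℝ × ℝ, -ε < q.2 → q.2 ≤ 0 →
      |u₀ q - u₀ (a, 0) - β * (q.1 - c * q.2 - a)| ≤
        C * (ε ^ (min s 2 / 2) + ε ^ (min s' 2 / 2) * layer x (κ / 2) ε a) *
          Real.exp (κ * (|q.1 - c * q.2 - a| / √ε)) := by
  have hκ2 : 0 < κ / 2 := by positivity
  obtain ⟨B', hB', hT'⟩ := hglobal.taylor hs' (undamaged_convex δ) (undamaged_interior hδ)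
  choose Bi hBi hTi using fun i =>
    (hlocal i).taylor hs.le (between_convex i) (between_interior hδ hL hx hx01 i)
  set B := ∑ i, Bi i with hB
  have hB0 : 0 ≤ B := Finset.sum_nonneg fun i _ => hBi i
  have hBle : ∀ i, Bi i ≤ B := fun i =>
    Finset.single_le_sum (f := Bi) (fun i _ => hBi i) (Finset.mem_univ i)
  obtain ⟨C₁, hC₁, hE₁⟩ := exists_taylor_le_exp (t := min s 2) hδ hΛ hκ
    (le_min hs.le zero_le_two) (min_le_right _ _)
  obtain ⟨C₂, hC₂, hE₂⟩ := exists_taylor_le_exp (t := min s' 2) hδ hΛ hκ2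
    (le_min hs' zero_le_two) (min_le_right _ _)
  obtain ⟨C₃, hC₃, hE₃⟩ := exists_rpow_le_mul_exp (κ := κ / 2) (b := 0) (t := 1) hκ2 le_rfl
    zero_le_one
  set C₄ := C₂ * B' + B * C₃ * δ ^ (1 / 2 - min s' 2 / 2) with hC₄
  have hC₄0 : 0 ≤ C₄ := by positivity
  set b := (Λ + 1 / L) * √δ with hb
  have hb0 : 0 ≤ b := by positivity
  refine ⟨C₁ * B + C₄ * Real.exp (κ / 2 * b) + 1, by positivity, ?_⟩
  intro ε c a hε hεδ hc
  have hσ : 0 < √ε := Real.sqrt_pos.2 hε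
  have hlay := layer_nonneg x (κ / 2) ε a
  have hexpb : 1 ≤ Real.exp (κ / 2 * b) := Real.one_le_exp (by positivity)
  have hglob : ∀ q : ℝ × ℝ, -ε < q.2 → q.2 ≤ 0 → ∀ a : ℝ,
      |u₀ q - u₀ (a, 0) - taylorGrad s' (undamaged δ) u₀ (a, 0) (1, 0) * (q.1 - c * q.2 - a)| ≤
        C₂ * B' * ε ^ (min s' 2 / 2) * Real.exp (κ / 2 * (|q.1 - c * q.2 - a| / √ε)) := by
    intro q hq1 hq2 a
    have hp : ((a, 0) : ℝ × ℝ) ∈ undamaged δ := ⟨by simpa using hδ, le_rfl⟩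
    have hq : q ∈ undamaged δ := ⟨by linarith, hq2⟩
    exact hE₂ B' ε c a u₀ _ q hε hεδ hc hq1 hq2 hB' (hT' _ hp).1 ((hT' _ hp).2 q hq)
  -- If a tip is this close to `a`, the layer at `a` is at least `exp (-κ (τ + b) / 2)`. Half of the
  -- exponential weight pays for inserting the layer, the other half for the remainder; hence the
  -- rate `κ / 2`.
  have hfar : ∀ (q : ℝ × ℝ) (X : ℝ) (j : Fin M),
      distInt (a - x j) ≤ √ε * (|q.1 - c * q.2 - a| / √ε + b) →
      X ≤ C₄ * ε ^ (min s' 2 / 2) * Real.exp (κ / 2 * (|q.1 - c * q.2 - a| / √ε)) →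
      X ≤ (C₁ * B + C₄ * Real.exp (κ / 2 * b) + 1) *
        (ε ^ (min s 2 / 2) + ε ^ (min s' 2 / 2) * layer x (κ / 2) ε a) *
          Real.exp (κ * (|q.1 - c * q.2 - a| / √ε)) := by
    intro q X j hj hX
    set τ := |q.1 - c * q.2 - a| / √ε with hτ
    have h1 : 1 ≤ layer x (κ / 2) ε a * Real.exp (κ / 2 * b) * Real.exp (κ / 2 * τ) := by
      have h2 : distInt (a - x j) / √ε ≤ τ + b := by rwa [div_le_iff₀' hσ]
      have h3 : 0 ≤ -(κ / 2 * (distInt (a - x j) / √ε)) + κ / 2 * b + κ / 2 * τ := by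
        nlinarith
      have h4 := Real.one_le_exp h3
      rw [Real.exp_add, Real.exp_add] at h4
      refine h4.trans ?_
      gcongr
      exact exp_le_layer x (κ / 2) ε a j
    have h5 : Real.exp (κ * τ) = Real.exp (κ / 2 * τ) * Real.exp (κ / 2 * τ) := by
      rw [← Real.exp_add]; congr 1; ring
    calc X ≤ C₄ * ε ^ (min s' 2 / 2) * Real.exp (κ / 2 * τ) := hX
      _ ≤ C₄ * ε ^ (min s' 2 / 2) * Real.exp (κ / 2 * τ) *
          (layer x (κ / 2) ε a * Real.exp (κ / 2 * b) * Real.exp (κ / 2 * τ)) :=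
          le_mul_of_one_le_right (by positivity) h1
      _ = C₄ * Real.exp (κ / 2 * b) * (ε ^ (min s' 2 / 2) * layer x (κ / 2) ε a) *
          Real.exp (κ * τ) := by rw [h5]; ring
      _ ≤ _ := by
          gcongr
          · have : 0 ≤ C₁ * B := by positivity
            linarith
          · exact le_add_of_nonneg_left (by positivity)
  rcases exists_tip_or_between hx01 a with ⟨i, n, hi⟩ | ⟨i, n, h1, h2⟩
  -- At a tip no region contains `(a, 0)`; the global expansion suffices, since the distance to the
  -- tip is zero.
  · refine ⟨taylorGrad s' (undamaged δ) u₀ (a, 0) (1, 0), fun q hq1 hq2 => hfar q _ i ?_ ?_⟩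
    · have : distInt (a - x i) = 0 := by
        rw [distInt, hi, add_sub_cancel_left, round_intCast, sub_self, abs_zero]
      rw [this]; positivity
    · refine (hglob q hq1 hq2 a).trans ?_
      gcongr
      exact le_add_of_nonneg_right (by positivity)
  · set p : ℝ × ℝ := (a - n, 0) with hp
    have hpU : p ∈ between δ L x i := by
      rw [mem_between_iff]
      have e1 : 0 < L * (a - n - leftTip x i) := mul_pos hL (by linarith)
      have e2 : 0 < L * (x i - (a - n)) := mul_pos hL (by linarith)
      refine ⟨⟨by simpa [hp] using hδ, le_rfl⟩, ⟨?_, ?_⟩, ?_, ?_⟩ <;> simp only [hp] <;> linarith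
    have hua : u₀ p = u₀ (a, 0) := map_sub_int_of_periodic hper n a 0
    obtain ⟨hG, hGT⟩ := hTi i p hpU
    set G := taylorGrad s (between δ L x i) u₀ p with hGdef
    have hGB : ‖G‖ ≤ B := hG.trans (hBle i)
    refine ⟨G (1, 0), fun q hq1 hq2 => ?_⟩
    have huq : u₀ (q.1 - n, q.2) = u₀ q := map_sub_int_of_periodic hper n q.1 q.2
    have hℓ : q.1 - n - c * q.2 - (a - n) = q.1 - c * q.2 - a := by ring
    by_cases hqU : (q.1 - n, q.2) ∈ between δ L x i
    · have hT := hGT _ hqU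
      have := hE₁ B ε c (a - n) u₀ G (q.1 - n, q.2) hε hεδ hc hq1 hq2 hB0 hGB
        (hT.trans (by gcongr; exact hBle i))
      simp only [hℓ] at this
      rw [← hp, hua, huq] at this
      refine this.trans ?_
      gcongr
      · have : 0 ≤ C₄ * Real.exp (κ / 2 * b) := by positivity
        linarith
      · exact le_add_of_nonneg_right (by positivity)
    · obtain ⟨j, hj⟩ := exists_tip_near hL hε hεδ hc h1 h2 hq1 hq2 hqU
      refine hfar q _ j hj ?_
      have hgl := hglob (q.1 - n, q.2) hq1 hq2 (a - n)
      simp only [hℓ] at hgl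
      rw [← hp, hua, huq] at hgl
      set τ := |q.1 - c * q.2 - a| / √ε with hτ
      have hτ0 : 0 ≤ τ := by positivity
      -- The slope was fixed by the region of `a`, so the global bound must be adapted to it. If `1
      -- < s'`, the global and regional gradients agree. Otherwise the global expansion has no
      -- linear term, and the regional one, of size `√ε τ`, is harmless because `s' ≤ 1`.
      by_cases hs1 : 1 < s'
      · have hs1' : 1 < s := hs1.trans_le hss'
        have hGG : taylorGrad s' (undamaged δ) u₀ p = G := by
          simp only [hGdef, taylorGrad, if_pos hs1, if_pos hs1']
          have hsub : between δ L x i ⊆ undamaged δ := fun y hy => hy.1.1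
          have hpS : p ∈ undamaged δ := hsub hpU
          exact (fderivWithin_subset hsub
            (uniqueDiffOn_convex (between_convex i) (between_interior hδ hL hx hx01 i) p hpU)
            (hglobal.differentiableOn hs1 p hpS)).symm
        rw [hGG] at hgl
        refine hgl.trans ?_
        gcongr
        exact le_add_of_nonneg_right (by positivity)
      · have hG0 : taylorGrad s' (undamaged δ) u₀ p = 0 := by
          simp only [taylorGrad, if_neg hs1]
        rw [hG0, zero_apply, zero_mul, sub_zero] at hgl
        have hlin : |G (1, 0) * (q.1 - c * q.2 - a)| ≤
            B * C₃ * δ ^ (1 / 2 - min s' 2 / 2) * ε ^ (min s' 2 / 2) * Real.exp (κ / 2 * τ) := by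
          have e1 : |G (1, 0)| ≤ B := by
            have := G.le_opNorm (1, 0)
            rw [Prod.norm_def] at this
            simp only [norm_one, norm_zero, Real.norm_eq_abs, zero_le_one, sup_of_le_left,
              mul_one] at this
            exact this.trans hGB
          have e2 : |q.1 - c * q.2 - a| = √ε * τ := by rw [hτ]; field_simp
          have e3 := hE₃ τ hτ0
          rw [add_zero, Real.rpow_one] at e3
          have e4 : √ε ≤ δ ^ (1 / 2 - min s' 2 / 2) * ε ^ (min s' 2 / 2) := by
            rw [Real.sqrt_eq_rpow]
            refine rpow_le_mul_rpow hε hεδ ?_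
            have := min_le_left s' 2
            linarith
          rw [abs_mul, e2]
          calc |G (1, 0)| * (√ε * τ) ≤ B * ((δ ^ (1 / 2 - min s' 2 / 2) * ε ^ (min s' 2 / 2)) *
                (C₃ * Real.exp (κ / 2 * τ))) := by gcongr
            _ = _ := by ring
        calc |u₀ q - u₀ (a, 0) - G (1, 0) * (q.1 - c * q.2 - a)|
            ≤ |u₀ q - u₀ (a, 0)| + |G (1, 0) * (q.1 - c * q.2 - a)| := abs_sub _ _
          _ ≤ _ := add_le_add hgl hlin
          _ = _ := by rw [hC₄]; ring

end boundary

/-! ### The pointwise error -/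

/-- The barrier estimate is applied, at each foot `a`, to the image minus the affine function of `ℓ`
supplied by `exists_boundary_bound`. Stencil and weights enter the constants only through `Λ`. -/
theorem exists_pointwise_error {M : ℕ} [NeZero M] {δ L : ℝ} {x : Fin M → ℝ} {u₀ : ℝ × ℝ → ℝ}
    {s s' : ℝ} (hδ : 0 < δ) (hL : 0 < L) (hs : 0 < s) (hs' : 0 ≤ s')
    (hss' : s' ≤ s) (hx : StrictMono x) (hx01 : ∀ i, x i ∈ Ioc (0 : ℝ) 1)
    (hper : ∀ a b : ℝ, u₀ (a + 1, b) = u₀ (a, b)) (hglobal : MemSobolevInf s' (undamaged δ) u₀)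
    (hlocal : ∀ i, MemSobolevInf s (between δ L x i) u₀) {Λ : ℝ} (hΛ : 1 ≤ Λ) :
    ∃ C, 0 < C ∧ ∃ κ, 0 < κ ∧ ∀ (r : ℝ) (N : ℕ) (S : Finset (ℝ × ℝ)) (ω : ℝ × ℝ → ℝ)
      (u : ℤ × ℤ → ℝ), Admissible r S ω → 0 < N → r * (1 / N) ≤ δ →
      r ≤ Λ * |(barycenter S ω).2| → HPeriodic N u →
      (∀ z : ℤ × ℤ, z.2 ≤ 0 → u z = u₀ ((z.1 : ℝ) / N, (z.2 : ℝ) / N)) →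
      (∀ z : ℤ × ℤ, 1 ≤ z.2 → z.2 ≤ N → avg S ω u z = u z) →
      ∀ z : ℤ × ℤ, 1 ≤ z.2 → z.2 ≤ N →
        |u₀ (foot (1 / N) ((barycenter S ω).1 / (barycenter S ω).2) z, 0) - u z| ≤
          C * ((r * (1 / N)) ^ (min s 2 / 2) + (r * (1 / N)) ^ (min s' 2 / 2) *
            layer x κ (r * (1 / N))
              (foot (1 / N) ((barycenter S ω).1 / (barycenter S ω).2) z)) := by
  obtain ⟨C, hC, hbd⟩ := exists_boundary_bound hδ hL hs hs' hss' hx hx01 hper hglobal hlocal hΛ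
    (rate_pos hΛ δ)
  refine ⟨2 * Real.exp (1 + δ) * C, by positivity, rate Λ δ / 2, half_pos (rate_pos hΛ δ), ?_⟩
  intro r N S ω u hS hN hrh hg hu_per hu_bd hu z hz1 hzN
  have hN' : (0 : ℝ) < N := by exact_mod_cast hN
  have hr := hS.one_le
  have hh : (0 : ℝ) < 1 / N := by positivity
  have hε : 0 < r * (1 / (N : ℝ)) := by positivity
  set c := (barycenter S ω).1 / (barycenter S ω).2 with hc
  set a := foot (1 / N) c z with ha
  set ε := r * (1 / (N : ℝ)) with hεdef
  have hcΛ : |c| ≤ Λ := by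
    rw [hc, abs_div, div_le_iff₀ (abs_pos.2 hS.drift.ne)]
    exact hS.abs_barycenter_fst_le.trans hg
  obtain ⟨β, hβ⟩ := hbd ε c a hε hrh hcΛ
  have hlay := layer_nonneg x (rate Λ δ / 2) ε a
  have key := hS.abs_le_of_boundary (n := N) (a := a) (c := c)
    (G := C * (ε ^ (min s 2 / 2) + ε ^ (min s' 2 / 2) * layer x (rate Λ δ / 2) ε a))
    (V := fun ζ => u ζ - (u₀ (a, 0) + β * (foot (1 / N) c ζ - a))) hΛ hh hrh
    (by rw [mul_one_div, div_self hN'.ne']) hg (by positivity) hc ?_ ?_ ?_ hz1 hzN ha.symm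
  · simp only [ha, sub_self, mul_zero, add_zero] at key
    rw [abs_sub_comm]
    refine key.trans (le_of_eq ?_)
    ring
  · intro ζ h1 h2
    rw [avg_sub u (fun ζ => u₀ (a, 0) + β * (foot (1 / N) c ζ - a)), hu ζ h1 h2]
    congr 1
    have e : (fun ζ : ℤ × ℤ => u₀ (a, 0) + β * (foot (1 / N) c ζ - a)) =
        fun ζ : ℤ × ℤ => ((u₀ (a, 0) - β * a) + 0 * (ζ.1 : ℝ) + 0 * (ζ.2 : ℝ)) +
          β * foot (1 / N) c ζ := by
      funext ζ; ring
    rw [e, avg_add (fun ζ : ℤ × ℤ => (u₀ (a, 0) - β * a) + 0 * (ζ.1 : ℝ) + 0 * (ζ.2 : ℝ))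
      (fun ζ => β * foot (1 / N) c ζ), avg_affine hS.mass_pos.ne', avg_const_mul]
    have := hS.avg_foot (1 / N) ζ
    rw [← hc] at this
    rw [show avg S ω (fun ζ => foot (1 / N) c ζ) ζ = foot (1 / N) c ζ from this]
    ring
  · obtain ⟨D, hD⟩ := hu_per.bounded_rows hN 1 N
    refine ⟨|D| + |u₀ (a, 0)| + |β|, fun ζ h1 h2 => ?_⟩
    have h3 := (hD ζ h1 h2).trans (le_abs_self D)
    have h4 : |u ζ - (u₀ (a, 0) + β * (foot (1 / N) c ζ - a))| ≤
        |u ζ| + (|u₀ (a, 0)| + |β| * |foot (1 / N) c ζ - a|) := by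
      refine (abs_sub _ _).trans (add_le_add le_rfl ((abs_add_le _ _).trans ?_))
      rw [abs_mul]
    have h5 := abs_nonneg (foot (1 / N) c ζ - a)
    nlinarith [mul_nonneg (abs_nonneg D) h5, mul_nonneg (abs_nonneg (u₀ (a, 0))) h5,
      abs_nonneg β]
  · intro ζ h1 h2
    have := hβ ((ζ.1 : ℝ) / N, (ζ.2 : ℝ) / N) ?_ ?_
    · have e : (ζ.1 : ℝ) / N - c * ((ζ.2 : ℝ) / N) - a = foot (1 / N) c ζ - a := by
        simp only [foot]; ring
      simp only [e] at this
      rw [hu_bd ζ h2, ← sub_sub]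
      exact this
    · simp only [hεdef]
      rw [mul_one_div, ← neg_div]
      gcongr
    · have : (ζ.2 : ℝ) ≤ 0 := by exact_mod_cast h2
      exact div_nonpos_of_nonpos_of_nonneg this hN'.le

/-! ### Summation over the boundary layers -/

/-- The nonnegative and the negative values of `f` are each compared with a full geometric series.
-/
theorem sum_pow_natAbs_le {ι : Type*} (J : Finset ι) {f : ι → ℤ} (hf : Set.InjOn f J) {ρ : ℝ}
    (h0 : 0 ≤ ρ) (h1 : ρ < 1) : ∑ j ∈ J, ρ ^ (f j).natAbs ≤ 2 * (1 - ρ)⁻¹ := by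
  classical
  have key : ∀ J' : Finset ι, Set.InjOn (fun j => (f j).natAbs) J' →
      ∑ j ∈ J', ρ ^ (f j).natAbs ≤ (1 - ρ)⁻¹ := by
    intro J' hinj
    rw [← Finset.sum_image (f := fun n : ℕ => ρ ^ n) (g := fun j => (f j).natAbs)
      (fun i hi j hj h => hinj hi hj h), ← tsum_geometric_of_lt_one h0 h1]
    exact (summable_geometric_of_lt_one h0 h1).sum_le_tsum _ fun n _ => pow_nonneg h0 n
  rw [← Finset.sum_filter_add_sum_filter_not J (fun j => 0 ≤ f j), two_mul]
  refine add_le_add (key _ ?_) (key _ ?_)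
  all_goals
    intro i hi j hj h
    simp only [Finset.coe_filter, mem_ofPred_eq] at hi hj h
    refine hf (Finset.mem_coe.2 hi.1) (Finset.mem_coe.2 hj.1) ?_
    omega

/-- Riemann sums of an exponentially decaying function of the distance to a point of the circle. -/
theorem exists_sum_exp_distInt_le {κ δ : ℝ} (hκ : 0 < κ) (hδ : 0 < δ) :
    ∃ C, 0 < C ∧ ∀ (N : ℕ) (ε b : ℝ), 0 < N → 1 / (N : ℝ) ≤ ε → ε ≤ δ →
      ∑ j ∈ Finset.Icc 1 (N : ℤ), Real.exp (-(κ * (distInt (j / N - b) / √ε))) * (1 / N) ≤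
        C * √ε := by
  refine ⟨2 * Real.exp (κ * √δ) * (√δ + 1 / κ), by positivity, ?_⟩
  intro N ε b hN hNε hεδ
  have hN' : (0 : ℝ) < N := by exact_mod_cast hN
  have hε : 0 < ε := lt_of_lt_of_le (by positivity) hNε
  have hσ : 0 < √ε := Real.sqrt_pos.2 hε
  set μ := κ / (N * √ε) with hμ
  have hμ0 : 0 < μ := by positivity
  set ρ := Real.exp (-μ) with hρ
  have hρ1 : ρ < 1 := by rw [hρ, Real.exp_lt_one_iff]; linarith
  -- Signed pixel offset of column `j` from the nearest periodic copy of `b`, with `N b` rounded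
  -- down. The rounding costs at most a factor `exp μ`; over one period `f` is injective, since
  -- equal values force `N ∣ i - j`.
  set f : ℤ → ℤ := fun j => j - N * round ((j : ℝ) / N - b) - ⌊(N : ℝ) * b⌋ with hf
  have hinj : Set.InjOn f (Finset.Icc 1 (N : ℤ)) := by
    intro i hi j hj h
    simp only [Finset.coe_Icc, mem_Icc, hf] at hi hj h
    have hdvd : (N : ℤ) ∣ i - j :=
      ⟨round ((i : ℝ) / N - b) - round ((j : ℝ) / N - b), by linarith⟩
    have := Int.eq_zero_of_abs_lt_dvd hdvd (by rw [abs_lt]; constructor <;> omega)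
    omega
  have hterm : ∀ j : ℤ, Real.exp (-(κ * (distInt (j / N - b) / √ε))) ≤
      Real.exp μ * ρ ^ (f j).natAbs := by
    intro j
    rw [hρ, ← Real.exp_nat_mul, ← Real.exp_add, Real.exp_le_exp]
    have h1 : N * distInt (j / N - b) = |(j : ℝ) - N * round ((j : ℝ) / N - b) - N * b| := by
      rw [distInt, ← abs_of_pos hN', ← abs_mul, abs_of_pos hN']
      congr 1; field_simp; ring
    have h2 : ((f j).natAbs : ℝ) ≤ N * distInt (j / N - b) + 1 := by
      rw [h1, Nat.cast_natAbs, Int.cast_abs]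
      have h3 : ((f j : ℤ) : ℝ) = ((j : ℝ) - N * round ((j : ℝ) / N - b) - N * b) +
          Int.fract ((N : ℝ) * b) := by
        simp only [hf, Int.fract]; push_cast; ring
      rw [h3]
      refine (abs_add_le _ _).trans (add_le_add le_rfl ?_)
      rw [abs_of_nonneg (Int.fract_nonneg _)]
      exact (Int.fract_lt_one _).le
    have h4 : κ * (distInt (j / N - b) / √ε) = μ * (N * distInt (j / N - b)) := by
      rw [hμ]; field_simp
    rw [h4]
    nlinarith
  have hgeo : (1 - ρ)⁻¹ ≤ 1 + 1 / μ := by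
    have h1 := Real.add_one_le_exp μ
    have h2 : ρ * Real.exp μ = 1 := by rw [hρ, ← Real.exp_add]; simp
    have h3 : 0 < ρ := Real.exp_pos _
    have h4 : ρ * (μ + 1) ≤ 1 := by nlinarith
    have h5 : μ / (1 + μ) ≤ 1 - ρ := by
      rw [div_le_iff₀ (by positivity)]; nlinarith
    calc (1 - ρ)⁻¹ ≤ (μ / (1 + μ))⁻¹ := by gcongr
      _ = 1 + 1 / μ := by field_simp; ring
  have hεσ : ε ≤ √ε * √δ := by
    calc ε = √ε * √ε := (Real.mul_self_sqrt hε.le).symm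
      _ ≤ _ := by gcongr
  have hμle : μ ≤ κ * √δ := by
    have e : μ = κ * ((1 / N) / √ε) := by rw [hμ]; field_simp
    rw [e]
    gcongr
    rw [div_le_iff₀ hσ]
    linarith
  calc ∑ j ∈ Finset.Icc 1 (N : ℤ), Real.exp (-(κ * (distInt (j / N - b) / √ε))) * (1 / N)
      ≤ ∑ j ∈ Finset.Icc 1 (N : ℤ), Real.exp μ * ρ ^ (f j).natAbs * (1 / N) := by
        gcongr with j _
        exact hterm j
    _ = Real.exp μ * (∑ j ∈ Finset.Icc 1 (N : ℤ), ρ ^ (f j).natAbs) * (1 / N) := by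
        rw [← Finset.sum_mul, ← Finset.mul_sum]
    _ ≤ Real.exp (κ * √δ) * (2 * (1 + 1 / μ)) * (1 / N) := by
        gcongr
        exact (sum_pow_natAbs_le _ hinj (Real.exp_pos _).le hρ1).trans (by gcongr)
    _ = 2 * Real.exp (κ * √δ) * (1 / N + √ε / κ) := by rw [hμ]; field_simp
    _ ≤ 2 * Real.exp (κ * √δ) * (√ε * √δ + √ε / κ) := by
        gcongr; linarith
    _ = _ := by ring

/-- Bounding the mean over the tips by its largest term allows every power `p₀ > 0`, including those
below one. In each row the foot is the column position shifted by a constant, so a one-dimensional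
Riemann sum remains. -/
theorem exists_sum_layer_le {M : ℕ} [NeZero M] (x : Fin M → ℝ) {κ δ p₀ : ℝ} (hκ : 0 < κ)
    (hδ : 0 < δ) (hp₀ : 0 < p₀) :
    ∃ C, 0 < C ∧ ∀ (N : ℕ) (ε c : ℝ), 0 < N → 1 / (N : ℝ) ≤ ε → ε ≤ δ →
      ∑ z ∈ pixels N, (layer x κ ε (foot (1 / N) c z) / M) ^ p₀ * (1 / (N : ℝ)) ^ 2 ≤ C * √ε := by
  obtain ⟨C, hC, hsum⟩ := exists_sum_exp_distInt_le (κ := κ * p₀) (by positivity) hδ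
  have hM : (0 : ℝ) < M := by exact_mod_cast Nat.pos_of_ne_zero (NeZero.ne M)
  refine ⟨M * C, by positivity, ?_⟩
  intro N ε c hN hNε hεδ
  have hN' : (0 : ℝ) < N := by exact_mod_cast hN
  have hlayer : ∀ a : ℝ, (layer x κ ε a / M) ^ p₀ ≤
      ∑ i, Real.exp (-(κ * p₀ * (distInt (a - x i) / √ε))) := by
    intro a
    obtain ⟨i, -, hi⟩ := Finset.exists_max_image Finset.univ
      (fun i => Real.exp (-(κ * (distInt (a - x i) / √ε)))) ⟨(0 : Fin M), Finset.mem_univ _⟩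
    have h1 : layer x κ ε a / M ≤ Real.exp (-(κ * (distInt (a - x i) / √ε))) := by
      rw [div_le_iff₀' hM]
      refine (Finset.sum_le_card_nsmul _ _ _ fun j hj => hi j hj).trans (le_of_eq ?_)
      simp
    calc (layer x κ ε a / M) ^ p₀ ≤ Real.exp (-(κ * (distInt (a - x i) / √ε))) ^ p₀ :=
          Real.rpow_le_rpow (div_nonneg (layer_nonneg _ _ _ _) hM.le) h1 hp₀.le
      _ = Real.exp (-(κ * p₀ * (distInt (a - x i) / √ε))) := by
          rw [← Real.exp_mul]; congr 1; ring
      _ ≤ _ := Finset.single_le_sum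
          (f := fun i => Real.exp (-(κ * p₀ * (distInt (a - x i) / √ε))))
          (fun _ _ => (Real.exp_pos _).le) (Finset.mem_univ i)
  calc ∑ z ∈ pixels N, (layer x κ ε (foot (1 / N) c z) / M) ^ p₀ * (1 / (N : ℝ)) ^ 2
      ≤ ∑ z ∈ pixels N, ∑ i, Real.exp (-(κ * p₀ * (distInt (foot (1 / N) c z - x i) / √ε))) *
          (1 / (N : ℝ)) ^ 2 := by
        refine Finset.sum_le_sum fun z _ => ?_
        rw [← Finset.sum_mul]
        gcongr
        exact hlayer _
    _ = ∑ i, ∑ m ∈ Finset.Icc 1 (N : ℤ), (∑ j ∈ Finset.Icc 1 (N : ℤ),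
          Real.exp (-(κ * p₀ * (distInt ((j : ℝ) / N - (c * m / N + x i)) / √ε))) * (1 / N)) *
            (1 / N) := by
        rw [Finset.sum_comm]
        refine Finset.sum_congr rfl fun i _ => ?_
        rw [pixels, Finset.sum_product_right]
        refine Finset.sum_congr rfl fun m _ => ?_
        rw [Finset.sum_mul]
        refine Finset.sum_congr rfl fun j _ => ?_
        have : foot (1 / N) c (j, m) - x i = (j : ℝ) / N - (c * m / N + x i) := by
          simp only [foot]; ring
        rw [this]; ring
    _ ≤ ∑ i : Fin M, ∑ m ∈ Finset.Icc 1 (N : ℤ), (C * √ε) * (1 / N) := by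
        gcongr with i _ m _
        exact hsum N ε _ hN hNε hεδ
    _ = M * C * √ε := by
        simp only [Finset.sum_const, Int.card_Icc, Finset.card_univ, Fintype.card_fin, nsmul_eq_mul,
          add_sub_cancel_right, Int.toNat_natCast]
        field_simp

/-! ### Discrete norms -/

theorem sum_pixels_weight {N : ℕ} (hN : 0 < N) :
    ∑ _z ∈ pixels N, (1 / (N : ℝ)) ^ 2 = 1 := by
  have hN' : (N : ℝ) ≠ 0 := by exact_mod_cast hN.ne'
  simp [pixels]
  field_simp

theorem discreteNorm_of_ne_top {N : ℕ} {p : ℝ≥0∞} (hp : p ≠ ∞) (f : ℤ × ℤ → ℝ) :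
    discreteNorm N p f =
      (∑ z ∈ pixels N, |f z| ^ p.toReal * (1 / (N : ℝ)) ^ 2) ^ (1 / p.toReal) := by
  rw [discreteNorm, if_neg hp]

theorem discreteNorm_le_of_forall_le {N : ℕ} (hN : 0 < N) {p : ℝ≥0∞} (hp : 0 < p)
    {f : ℤ × ℤ → ℝ} {b : ℝ} (hb : 0 ≤ b) (h : ∀ z ∈ pixels N, |f z| ≤ b) :
    discreteNorm N p f ≤ b := by
  by_cases hpt : p = ∞
  · rw [discreteNorm, if_pos hpt]
    have : ((pixels N).sup fun z => ‖f z‖₊) ≤ b.toNNReal := by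
      refine Finset.sup_le fun z hz => ?_
      rw [← NNReal.coe_le_coe, Real.coe_toNNReal b hb, coe_nnnorm, Real.norm_eq_abs]
      exact h z hz
    calc (((pixels N).sup fun z => ‖f z‖₊ : NNReal) : ℝ) ≤ (b.toNNReal : ℝ) :=
          NNReal.coe_le_coe.2 this
      _ = b := Real.coe_toNNReal b hb
  · have hp' : 0 < p.toReal := ENNReal.toReal_pos hp.ne' hpt
    rw [discreteNorm_of_ne_top hpt]
    calc (∑ z ∈ pixels N, |f z| ^ p.toReal * (1 / (N : ℝ)) ^ 2) ^ (1 / p.toReal)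
        ≤ (∑ z ∈ pixels N, b ^ p.toReal * (1 / (N : ℝ)) ^ 2) ^ (1 / p.toReal) := by
          gcongr with z hz
          exact h z hz
      _ = b := by
          rw [← Finset.mul_sum, sum_pixels_weight hN, mul_one, ← Real.rpow_mul hb,
            mul_one_div_cancel hp'.ne', Real.rpow_one]

/-- The normalized `L^p` norms increase with `p`. -/
theorem rpow_sum_pixels_mono {N : ℕ} (hN : 0 < N) {p q : ℝ} (hp : 0 < p) (hpq : p ≤ q)
    (f : ℤ × ℤ → ℝ) :
    (∑ z ∈ pixels N, |f z| ^ p * (1 / (N : ℝ)) ^ 2) ^ (1 / p) ≤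
      (∑ z ∈ pixels N, |f z| ^ q * (1 / (N : ℝ)) ^ 2) ^ (1 / q) := by
  have hq : 0 < q := hp.trans_le hpq
  have key := Real.rpow_arith_mean_le_arith_mean_rpow (pixels N) (fun _ => (1 / (N : ℝ)) ^ 2)
    (fun z => |f z| ^ p) (fun _ _ => by positivity) (sum_pixels_weight hN)
    (fun _ _ => by positivity) (p := q / p) ((one_le_div hp).2 hpq)
  have e : ∀ z, (|f z| ^ p) ^ (q / p) = |f z| ^ q := fun z => by
    rw [← Real.rpow_mul (abs_nonneg _), mul_div_cancel₀ _ hp.ne']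
  simp only [e, mul_comm ((1 / (N : ℝ)) ^ 2)] at key
  have h0 : 0 ≤ ∑ z ∈ pixels N, |f z| ^ p * (1 / (N : ℝ)) ^ 2 :=
    Finset.sum_nonneg fun _ _ => by positivity
  calc (∑ z ∈ pixels N, |f z| ^ p * (1 / (N : ℝ)) ^ 2) ^ (1 / p)
      = ((∑ z ∈ pixels N, |f z| ^ p * (1 / (N : ℝ)) ^ 2) ^ (q / p)) ^ (1 / q) := by
        rw [← Real.rpow_mul h0]; congr 1; field_simp
    _ ≤ _ := by gcongr

theorem rpow_le_max_one {δ e : ℝ} (hδ : 0 < δ) (he0 : 0 ≤ e) (he1 : e ≤ 1) :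
    δ ^ e ≤ max 1 δ := by
  calc δ ^ e ≤ (max 1 δ) ^ e := Real.rpow_le_rpow hδ.le (le_max_right _ _) he0
    _ ≤ (max 1 δ) ^ (1 : ℝ) := Real.rpow_le_rpow_of_exponent_le (le_max_left _ _) he1
    _ = _ := Real.rpow_one _

/-- The norm of a function that consists of a uniformly small part and of a larger part
concentrated in layers of width `√ε`, for exponents that are not too small. -/
theorem rpow_sum_pixels_le {N : ℕ} (hN : 0 < N) {t t' ε δ C C' p₀ p : ℝ} (ht' : 0 ≤ t')
    (ht2 : t ≤ 2) (hε : 0 < ε) (hεδ : ε ≤ δ) (hC : 0 ≤ C) (hC' : 0 ≤ C') (hp₀ : 0 < p₀)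
    (hpp : p₀ ≤ p) (hγ : t' / 2 + 1 / p / 2 ≤ t / 2) {f lam : ℤ × ℤ → ℝ} (hl0 : ∀ z, 0 ≤ lam z)
    (hl1 : ∀ z, lam z ≤ 1)
    (hf : ∀ z ∈ pixels N, |f z| ≤ C * (ε ^ (t / 2) + ε ^ (t' / 2) * lam z))
    (hsum : ∑ z ∈ pixels N, lam z ^ p₀ * (1 / (N : ℝ)) ^ 2 ≤ C' * √ε) :
    (∑ z ∈ pixels N, |f z| ^ p * (1 / (N : ℝ)) ^ 2) ^ (1 / p) ≤
      2 * C * max 1 δ * (1 + C') ^ (1 / p₀) * ε ^ (t' / 2 + 1 / p / 2) := by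
  have hp : 0 < p := hp₀.trans_le hpp
  have hδ : 0 < δ := hε.trans_le hεδ
  set D := max 1 δ with hD
  have hD1 : 1 ≤ D := le_max_left _ _
  set η := ε ^ (1 / p / 2) with hη
  have hη0 : 0 < η := Real.rpow_pos_of_pos hε _
  have hηp : η ^ p = √ε := by
    rw [hη, ← Real.rpow_mul hε.le, Real.sqrt_eq_rpow]; congr 1; field_simp
  set A := 2 * (C * D * ε ^ (t' / 2)) with hA
  have hA0 : 0 ≤ A := by positivity
  have hpt : ∀ z ∈ pixels N, |f z| ^ p ≤ A ^ p * (√ε + lam z ^ p₀) := by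
    intro z hz
    have h1 : ε ^ (t / 2) ≤ D * (ε ^ (t' / 2) * η) := by
      rw [hη, ← Real.rpow_add hε]
      refine (rpow_le_mul_rpow hε hεδ hγ).trans ?_
      gcongr
      refine rpow_le_max_one hδ (by linarith) ?_
      have : 0 ≤ 1 / p / 2 := by positivity
      linarith
    have h2 : ε ^ (t' / 2) * lam z ≤ D * (ε ^ (t' / 2) * lam z) :=
      le_mul_of_one_le_left (mul_nonneg (by positivity) (hl0 z)) hD1
    have h3 : |f z| ≤ A * max η (lam z) := by
      calc |f z| ≤ C * (ε ^ (t / 2) + ε ^ (t' / 2) * lam z) := hf z hz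
        _ ≤ C * (D * (ε ^ (t' / 2) * η) + D * (ε ^ (t' / 2) * lam z)) := by gcongr
        _ ≤ C * (D * (ε ^ (t' / 2) * max η (lam z)) + D * (ε ^ (t' / 2) * max η (lam z))) := by
            gcongr
            exacts [le_max_left _ _, le_max_right _ _]
        _ = _ := by rw [hA]; ring
    -- Where `lam` dominates, `lam ≤ 1` and `p₀ ≤ p` give `lam ^ p ≤ lam ^ p₀`. One summation bound
    -- at `p₀` thus serves all larger exponents.
    have h4 : (max η (lam z)) ^ p ≤ √ε + lam z ^ p₀ := by
      rcases max_cases η (lam z) with ⟨e, _⟩ | ⟨e, hlt⟩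
      · rw [e, hηp]
        exact le_add_of_nonneg_right (Real.rpow_nonneg (hl0 z) _)
      · rw [e]
        refine le_trans ?_ (le_add_of_nonneg_left (Real.sqrt_nonneg ε))
        exact Real.rpow_le_rpow_of_exponent_ge (hη0.trans hlt) (hl1 z) hpp
    calc |f z| ^ p ≤ (A * max η (lam z)) ^ p := Real.rpow_le_rpow (abs_nonneg _) h3 hp.le
      _ = A ^ p * (max η (lam z)) ^ p := Real.mul_rpow hA0 (hη0.le.trans (le_max_left _ _))
      _ ≤ _ := by gcongr
  have hmean : ∑ z ∈ pixels N, |f z| ^ p * (1 / (N : ℝ)) ^ 2 ≤ A ^ p * ((1 + C') * √ε) := by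
    calc ∑ z ∈ pixels N, |f z| ^ p * (1 / (N : ℝ)) ^ 2
        ≤ ∑ z ∈ pixels N, A ^ p * (√ε + lam z ^ p₀) * (1 / (N : ℝ)) ^ 2 := by
          gcongr with z hz
          exact hpt z hz
      _ = A ^ p * (√ε * ∑ z ∈ pixels N, (1 / (N : ℝ)) ^ 2 +
          ∑ z ∈ pixels N, lam z ^ p₀ * (1 / (N : ℝ)) ^ 2) := by
          rw [Finset.mul_sum, ← Finset.sum_add_distrib, Finset.mul_sum]
          exact Finset.sum_congr rfl fun z _ => by ring
      _ ≤ A ^ p * (√ε + C' * √ε) := by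
          rw [sum_pixels_weight hN, mul_one]; gcongr
      _ = _ := by ring
  calc (∑ z ∈ pixels N, |f z| ^ p * (1 / (N : ℝ)) ^ 2) ^ (1 / p)
      ≤ (A ^ p * ((1 + C') * √ε)) ^ (1 / p) := by gcongr
    _ = A * ((1 + C') ^ (1 / p) * η) := by
        rw [Real.mul_rpow (Real.rpow_nonneg hA0 p) (by positivity),
          Real.mul_rpow (by positivity) (Real.sqrt_nonneg ε), ← Real.rpow_mul hA0,
          mul_one_div_cancel hp.ne', Real.rpow_one, ← hηp, ← Real.rpow_mul hη0.le,
          mul_one_div_cancel hp.ne', Real.rpow_one]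
    _ ≤ A * ((1 + C') ^ (1 / p₀) * η) := by
        gcongr
        linarith
    _ = _ := by rw [hA, Real.rpow_add hε, hη]; ring

/-- The bound for all exponents, with a constant that does not depend on the exponent. -/
theorem discreteNorm_le {N : ℕ} (hN : 0 < N) {t t' ε δ C C' : ℝ} (ht' : 0 ≤ t') (htt' : t' ≤ t)
    (ht2 : t ≤ 2) (hε : 0 < ε) (hεδ : ε ≤ δ) (hC : 0 ≤ C) (hC' : 0 ≤ C')
    {f lam : ℤ × ℤ → ℝ} (hl0 : ∀ z, 0 ≤ lam z) (hl1 : ∀ z, lam z ≤ 1)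
    (hf : ∀ z ∈ pixels N, |f z| ≤ C * (ε ^ (t / 2) + ε ^ (t' / 2) * lam z))
    (hsum : t' < t → ∑ z ∈ pixels N, lam z ^ (1 / (t - t')) * (1 / (N : ℝ)) ^ 2 ≤ C' * √ε)
    {p : ℝ≥0∞} (hp : 0 < p) :
    discreteNorm N p f ≤ 2 * C * max 1 δ * (1 + C') ^ (t - t') *
      ε ^ (min (t' / 2 + (p⁻¹).toReal / 2) (t / 2)) := by
  have hδ : 0 < δ := hε.trans_le hεδ
  have hD1 : 1 ≤ max 1 δ := le_max_left _ _
  have hC1 : 1 ≤ (1 + C') ^ (t - t') := Real.one_le_rpow (by linarith) (by linarith)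
  by_cases hcase : p = ∞ ∨ t' = t
  · have hγ : min (t' / 2 + (p⁻¹).toReal / 2) (t / 2) = t' / 2 := by
      rcases hcase with rfl | rfl
      · simp only [ENNReal.inv_top, ENNReal.toReal_zero, zero_div, add_zero]
        exact min_eq_left (by linarith)
      · refine min_eq_right ?_
        have : 0 ≤ (p⁻¹).toReal := ENNReal.toReal_nonneg
        linarith
    rw [hγ]
    refine discreteNorm_le_of_forall_le hN hp (by positivity) fun z hz => (hf z hz).trans ?_
    have h1 : ε ^ (t / 2) ≤ max 1 δ * ε ^ (t' / 2) := by
      refine (rpow_le_mul_rpow (b := t' / 2) hε hεδ (by linarith)).trans ?_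
      gcongr
      exact rpow_le_max_one hδ (by linarith) (by linarith)
    have h2 : ε ^ (t' / 2) * lam z ≤ max 1 δ * ε ^ (t' / 2) := by
      calc ε ^ (t' / 2) * lam z ≤ ε ^ (t' / 2) * 1 := by gcongr; exact hl1 z
        _ ≤ _ := by rw [mul_one]; exact le_mul_of_one_le_left (by positivity) hD1
    calc C * (ε ^ (t / 2) + ε ^ (t' / 2) * lam z)
        ≤ C * (max 1 δ * ε ^ (t' / 2) + max 1 δ * ε ^ (t' / 2)) := by gcongr
      _ = 2 * C * max 1 δ * 1 * ε ^ (t' / 2) := by ring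
      _ ≤ _ := by gcongr
  · push Not at hcase
    obtain ⟨hpt, hne⟩ := hcase
    have hlt : t' < t := lt_of_le_of_ne htt' hne
    have hd : 0 < t - t' := by linarith
    have hp' : 0 < p.toReal := ENNReal.toReal_pos hp.ne' hpt
    have hpinv : (p⁻¹).toReal = 1 / p.toReal := by rw [ENNReal.toReal_inv, one_div]
    have hp₀ : 0 < 1 / (t - t') := by positivity
    rw [discreteNorm_of_ne_top hpt, hpinv]
    -- At `p = 1 / (t - t')` the two candidate rates coincide. Larger `p` use the layer estimate;
    -- smaller `p` reduce to this threshold by monotonicity of the norms, which keeps the constant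
    -- independent of `p`.
    rcases le_total (1 / (t - t')) p.toReal with h | h
    · have hγ : t' / 2 + 1 / p.toReal / 2 ≤ t / 2 := by
        have : 1 / p.toReal ≤ t - t' := by
          rw [div_le_iff₀ hd] at h
          rw [div_le_iff₀ hp']
          linarith
        linarith
      rw [min_eq_left hγ]
      have := rpow_sum_pixels_le hN ht' ht2 hε hεδ hC hC' hp₀ h hγ hl0 hl1 hf (hsum hlt)
      rwa [one_div_one_div] at this
    · have e : t' / 2 + 1 / (1 / (t - t')) / 2 = t / 2 := by rw [one_div_one_div]; ring
      have hγ : t / 2 ≤ t' / 2 + 1 / p.toReal / 2 := by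
        have : t - t' ≤ 1 / p.toReal := by
          rw [le_div_iff₀ hd] at h
          rw [le_div_iff₀ hp']
          linarith
        linarith
      rw [min_eq_right hγ]
      refine (rpow_sum_pixels_mono hN hp' h f).trans ?_
      have := rpow_sum_pixels_le hN ht' ht2 hε hεδ hC hC' hp₀ le_rfl e.le hl0 hl1 hf (hsum hlt)
      rw [e] at this
      rwa [one_div_one_div] at this ⊢

/-! ### Angles and transport -/

/-- Reduction modulo `π` multiplies sine and cosine by the same sign. -/
theorem cot_lineAngle {g : ℝ × ℝ} (hg : g.2 ≠ 0) : Real.cot (lineAngle g) = g.1 / g.2 := by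
  set ζ : ℂ := ⟨g.1, g.2⟩ with hζ
  have hζ0 : ζ ≠ 0 := fun h => hg (by have := congrArg Complex.im h; simpa [hζ] using this)
  have hn : ‖ζ‖ ≠ 0 := norm_ne_zero_iff.2 hζ0
  have e : lineAngle g = ζ.arg - (toIcoDiv Real.pi_pos 0 ζ.arg : ℝ) * Real.pi := by
    rw [lineAngle, toIcoMod, zsmul_eq_mul]
  rw [Real.cot_eq_cos_div_sin, e, Real.cos_sub_int_mul_pi, Real.sin_sub_int_mul_pi,
    mul_div_mul_left _ _ (zpow_ne_zero _ (by norm_num)), Complex.cos_arg hζ0, Complex.sin_arg,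
    div_div_div_cancel_right₀ hn]

theorem sin_lineAngle_nonneg (g : ℝ × ℝ) : 0 ≤ Real.sin (lineAngle g) := by
  have h := toIcoMod_mem_Ico Real.pi_pos 0 (Complex.arg ⟨g.1, g.2⟩)
  rw [zero_add] at h
  exact Real.sin_nonneg_of_nonneg_of_le_pi h.1 h.2.le

theorem map_transport {u₀ : ℝ × ℝ → ℝ} (hper : ∀ a b : ℝ, u₀ (a + 1, b) = u₀ (a, b)) (θ : ℝ)
    (N : ℕ) (z : ℤ × ℤ) :
    u₀ (transport θ ((z.1 : ℝ) / N, (z.2 : ℝ) / N)) = u₀ (foot (1 / N) (Real.cot θ) z, 0) := by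
  have e : (z.1 : ℝ) / N - Real.cot θ * ((z.2 : ℝ) / N) = foot (1 / N) (Real.cot θ) z := by
    simp only [foot]; ring
  simp only [transport, e, toIocMod, zsmul_eq_mul, mul_one]
  exact map_sub_int_of_periodic hper _ _ _

/-! ### The error constant -/

/-- Every sequence has a continuous, strictly increasing majorant. -/
theorem exists_continuous_strictMono_majorant (f : ℕ → ℝ) :
    ∃ F : ℝ → ℝ, Continuous F ∧ StrictMono F ∧ ∀ t, 0 ≤ t → f ⌈t⌉₊ ≤ F t := by
  set G : ℝ → ℝ := fun t => ∑ n ∈ Finset.range (⌈t⌉₊ + 1), |f n| with hG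
  have hGmono : Monotone G := fun a b hab =>
    Finset.sum_le_sum_of_subset_of_nonneg
      (Finset.range_mono (Nat.add_le_add_right (Nat.ceil_mono hab) 1)) fun _ _ _ => abs_nonneg _
  have hG0 : ∀ t, 0 ≤ G t := fun t => Finset.sum_nonneg fun _ _ => abs_nonneg _
  have hint : ∀ a b, IntervalIntegrable G MeasureTheory.volume a b := fun a b =>
    hGmono.intervalIntegrable
  -- `G` is increasing and majorizes the values of `f`. Its primitive is continuous, and for `t ≥ 0`
  -- the interval `[t, t + 1]` alone contributes at least `G t`; the summand `t` makes the growth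
  -- strict.
  refine ⟨fun t => t + ∫ s in (0 : ℝ)..(t + 1), G s, ?_, ?_, ?_⟩
  · exact continuous_id.add
      ((intervalIntegral.continuous_primitive hint 0).comp (continuous_id.add continuous_const))
  · intro a b hab
    have h1 := intervalIntegral.integral_add_adjacent_intervals (hint 0 (a + 1))
      (hint (a + 1) (b + 1))
    have h2 : 0 ≤ ∫ s in (a + 1)..(b + 1), G s :=
      intervalIntegral.integral_nonneg (by linarith) fun s _ => hG0 s
    simp only
    linarith
  · intro t ht
    have h1 := intervalIntegral.integral_add_adjacent_intervals (hint 0 t) (hint t (t + 1))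
    have h2 : 0 ≤ ∫ s in (0 : ℝ)..t, G s :=
      intervalIntegral.integral_nonneg ht fun s _ => hG0 s
    have h3 : ∫ _s in t..(t + 1), G t ≤ ∫ s in t..(t + 1), G s :=
      intervalIntegral.integral_mono_on (by linarith) (by simp) (hint _ _)
        fun s hs => hGmono hs.1
    rw [intervalIntegral.integral_const, add_sub_cancel_left, one_smul] at h3
    have h4 : f ⌈t⌉₊ ≤ G t := (le_abs_self _).trans
      (Finset.single_le_sum (f := fun n => |f n|) (fun _ _ => abs_nonneg _)
        (Finset.mem_range.2 (Nat.lt_succ_self _)))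
    simp only
    linarith

/-- Capping both smoothness orders at two is what caps the rate at one. -/
theorem error_exponent_eq {s s' P : ℝ} (hss' : s' ≤ s) (hP : 0 ≤ P) :
    min (min (s' / 2 + P / 2) (s / 2)) 1 = min (min s' 2 / 2 + P / 2) (min s 2 / 2) := by
  rcases le_total s 2 with h | h <;> rcases le_total s' 2 with h' | h'
  · rw [min_eq_left h, min_eq_left h', min_eq_left (b := (1 : ℝ))]
    exact (min_le_right _ _).trans (by linarith)
  · have : s = 2 := by linarith
    have : s' = 2 := by linarith
    subst_vars; norm_num
  · rw [min_eq_left h', min_eq_right h, min_assoc, min_eq_right (a := s / 2) (by linarith)]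
    norm_num
  · rw [min_eq_right h', min_eq_right h, min_eq_right (le_min (by linarith) (by linarith)),
      min_eq_right (by linarith)]
    norm_num

/-- The error bound with a constant that is uniform over all methods with `r / |g₂| ≤ Λ`. -/
theorem exists_error_bound {M : ℕ} [NeZero M] {δ L : ℝ} {x : Fin M → ℝ} {u₀ : ℝ × ℝ → ℝ}
    {s s' : ℝ} (hδ : 0 < δ) (hL : 0 < L) (hs : 0 < s) (hs' : 0 ≤ s')
    (hss' : s' ≤ s) (hx : StrictMono x) (hx01 : ∀ i, x i ∈ Ioc (0 : ℝ) 1)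
    (hper : ∀ a b : ℝ, u₀ (a + 1, b) = u₀ (a, b)) (hglobal : MemSobolevInf s' (undamaged δ) u₀)
    (hlocal : ∀ i, MemSobolevInf s (between δ L x i) u₀) {Λ : ℝ} (hΛ : 1 ≤ Λ) :
    ∃ K, ∀ (method : Method) (r : ℝ) (N : ℕ) (A : Finset (ℝ × ℝ)) (w : ℝ × ℝ → ℝ)
      (u : ℤ × ℤ → ℝ), Admissible r (stencil method A) (fun y => w (r⁻¹ • y)) → 0 < N →
      r * (1 / (N : ℝ)) ≤ δ → r / |(centerOfMass method r A w).2| ≤ Λ →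
      IsInpainted method N r A w u₀ u → ∀ p : ℝ≥0∞, 0 < p →
        discreteNorm N p (fun z => u₀ (transport (lineAngle (centerOfMass method r A w))
          ((z.1 : ℝ) / N, (z.2 : ℝ) / N)) - u z) ≤
        K * (r * (1 / (N : ℝ))) ^ (min (min (s' / 2 + (p⁻¹).toReal / 2) (s / 2)) 1) := by
  obtain ⟨C, hC, κ, hκ, herr⟩ :=
    exists_pointwise_error hδ hL hs hs' hss' hx hx01 hper hglobal hlocal hΛ
  have hM : (0 : ℝ) < M := by exact_mod_cast Nat.pos_of_ne_zero (NeZero.ne M)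
  have hM1 : (1 : ℝ) ≤ M := by exact_mod_cast Nat.pos_of_ne_zero (NeZero.ne M)
  have htt' : min s' 2 ≤ min s 2 := min_le_min_right _ hss'
  obtain ⟨C', hC', hsum⟩ : ∃ C', 0 < C' ∧ (min s' 2 < min s 2 → ∀ (N : ℕ) (ε c : ℝ), 0 < N →
      1 / (N : ℝ) ≤ ε → ε ≤ δ → ∑ z ∈ pixels N, (layer x κ ε (foot (1 / N) c z) / M) ^
        (1 / (min s 2 - min s' 2)) * (1 / (N : ℝ)) ^ 2 ≤ C' * √ε) := by
    by_cases h : min s' 2 < min s 2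
    · have hd : 0 < min s 2 - min s' 2 := by linarith
      obtain ⟨C', hC', h'⟩ := exists_sum_layer_le x hκ hδ (one_div_pos.2 hd)
      exact ⟨C', hC', fun _ => h'⟩
    · exact ⟨1, one_pos, fun h' => absurd h' h⟩
  -- Dividing the layer by its number of terms `M` brings it into `[0, 1]`; the factor `M`
  -- compensates.
  refine ⟨2 * (C * M) * max 1 δ * (1 + C') ^ (min s 2 - min s' 2), ?_⟩
  intro method r N A w u hS hN hrh hρ hu p hp
  obtain ⟨hu_per, hu_bd, hu_avg⟩ := hu.properties hS
  have hr := hS.one_le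
  have hN' : (0 : ℝ) < N := by exact_mod_cast hN
  have hg2 : (centerOfMass method r A w).2 ≠ 0 := hS.drift.ne
  have hg : r ≤ Λ * |(centerOfMass method r A w).2| := by
    rwa [div_le_iff₀ (abs_pos.2 hg2)] at hρ
  have hε : 0 < r * (1 / (N : ℝ)) := by positivity
  have hpt := herr r N _ _ u hS hN hrh hg hu_per hu_bd hu_avg
  have hbar : barycenter (stencil method A) (fun y => w (r⁻¹ • y)) = centerOfMass method r A w := rfl
  rw [hbar] at hpt
  rw [error_exponent_eq hss' ENNReal.toReal_nonneg]
  refine discreteNorm_le hN (le_min hs' zero_le_two) htt' (min_le_right _ _) hε hrh (by positivity)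
    hC'.le (lam := fun z => layer x κ (r * (1 / (N : ℝ)))
      (foot (1 / N) (Real.cot (lineAngle (centerOfMass method r A w))) z) / M)
    (fun z => div_nonneg (layer_nonneg _ _ _ _) hM.le) (fun z => ?_) (fun z hz => ?_)
    (fun h => hsum h N _ _ hN (le_mul_of_one_le_left (by positivity) hr) hrh) hp
  · rw [div_le_one hM]
    refine (Finset.sum_le_card_nsmul _ _ 1 fun i _ => ?_).trans (le_of_eq (by simp))
    rw [Real.exp_le_one_iff, neg_nonpos]
    have := distInt_nonneg (foot (1 / N) (Real.cot (lineAngle (centerOfMass method r A w))) z - x i)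
    positivity
  · simp only [pixels, Finset.mem_product, Finset.mem_Icc] at hz
    rw [map_transport hper, cot_lineAngle hg2]
    refine (hpt z hz.2.1 hz.2.2).trans ?_
    have e : ∀ X Y l : ℝ, C * M * (X + Y * (l / M)) = C * (M * X + Y * l) := by
      intro X Y l; field_simp
    rw [e]
    gcongr
    exact le_mul_of_one_le_left (by positivity) hM1

end Inpainting

/-! ### Choice of the constant `K` -/

theorem theorem1
    (δ L s s' : ℝ) (hδ : 0 < δ) (hL : 0 < L) (hs : 0 < s) (hs' : 0 ≤ s') (hss' : s' ≤ s)
    (M : ℕ) [NeZero M] (x : Fin M → ℝ) (hx : StrictMono x) (hx01 : ∀ i, x i ∈ Set.Ioc (0 : ℝ) 1)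
    (u₀ : ℝ × ℝ → ℝ) (hper : ∀ a b : ℝ, u₀ (a + 1, b) = u₀ (a, b))
    (hglobal : Inpainting.MemSobolevInf s' (Inpainting.undamaged δ) u₀)
    (hlocal : ∀ i, Inpainting.MemSobolevInf s (Inpainting.between δ L x i) u₀) :
    ∃ K : ℝ → ℝ → ℝ,
      ContinuousOn (Function.uncurry K) (Set.Ioi (0 : ℝ) ×ˢ Set.Ioo 0 Real.pi) ∧
      (∀ θ ∈ Set.Ioo 0 Real.pi, StrictMonoOn (fun ρ => K ρ θ) (Set.Ioi (0 : ℝ))) ∧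
      (∀ ρ : ℝ, 0 < ρ → Tendsto (K ρ) (𝓝[>] 0) atTop ∧ Tendsto (K ρ) (𝓝[<] Real.pi) atTop) ∧
      ∀ (method : Inpainting.Method) (r : ℝ) (_ : 1 ≤ r)
        (N : ℕ) (_ : 0 < N) (_ : 1 / (N : ℝ) < δ / (r + 2))
        (A : Finset (ℝ × ℝ)) (_ : ∀ y ∈ A, y.1 ^ 2 + y.2 ^ 2 ≤ r ^ 2)
        (w : ℝ × ℝ → ℝ) (_ : ∀ y, 0 ≤ w y)
        (_ : 0 < Inpainting.totalMass method r A w)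
        (g : ℝ × ℝ) (_ : g = Inpainting.centerOfMass method r A w) (_ : g.2 ≠ 0),
        (∃! u : ℤ × ℤ → ℝ, Inpainting.IsInpainted method N r A w u₀ u) ∧
        ∀ u : ℤ × ℤ → ℝ, Inpainting.IsInpainted method N r A w u₀ u →
          ∀ p : ℝ≥0∞, 0 < p →
            Inpainting.discreteNorm N p
              (fun z => u₀ (Inpainting.transport (Inpainting.lineAngle g)
                ((z.1 : ℝ) / N, (z.2 : ℝ) / N)) - u z)
            ≤ K (r / |g.2|) (Inpainting.lineAngle g) *
                (r * (1 / (N : ℝ))) ^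
                  (min (min (s' / 2 + (p⁻¹).toReal / 2) (s / 2)) 1) := by
  -- One constant for each bound `n + 1` on `r / |g₂|`; the shift ensures `Λ ≥ 1`.
  have hbound := fun n : ℕ => Inpainting.exists_error_bound hδ hL hs hs' hss' hx hx01 hper hglobal
    hlocal (Λ := n + 1) (by linarith [(Nat.cast_nonneg n : (0 : ℝ) ≤ n)])
  choose k hk using hbound
  obtain ⟨F, hFc, hFm, hF⟩ := Inpainting.exists_continuous_strictMono_majorant k
  -- Since `|cot θ| ≤ r / |g₂|`, the term `F ρ` alone controls the error. The nonnegative second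
  -- summand supplies the divergence as `θ` tends to `0` or `π`.
  refine ⟨fun ρ θ => F ρ + (Real.sin θ)⁻¹, ?_, ?_, ?_, ?_⟩
  · refine ContinuousOn.add (hFc.comp continuous_fst).continuousOn
      (ContinuousOn.inv₀ (Real.continuous_sin.comp continuous_snd).continuousOn ?_)
    exact fun q hq => (Real.sin_pos_of_pos_of_lt_pi hq.2.1 hq.2.2).ne'
  · intro θ _ a _ b _ hab
    have := hFm hab
    simp only
    linarith
  · have hsin : ∀ {l : Filter ℝ} {a : ℝ}, Real.sin a = 0 → l ≤ 𝓝 a →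
        (∀ᶠ θ in l, 0 < θ ∧ θ < Real.pi) → Tendsto (fun θ => (Real.sin θ)⁻¹) l atTop := by
      intro l a ha hl hev
      refine tendsto_inv_nhdsGT_zero.comp (tendsto_nhdsWithin_iff.2 ⟨?_, ?_⟩)
      · have := (Real.continuous_sin.tendsto a).mono_left hl
        rwa [ha] at this
      · filter_upwards [hev] with θ hθ
        exact Real.sin_pos_of_pos_of_lt_pi hθ.1 hθ.2
    intro ρ _
    constructor
    · exact tendsto_atTop_add_const_left _ _ (hsin Real.sin_zero nhdsWithin_le_nhds
        (Ioo_mem_nhdsGT Real.pi_pos))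
    · exact tendsto_atTop_add_const_left _ _ (hsin Real.sin_pi nhdsWithin_le_nhds
        (Ioo_mem_nhdsLT Real.pi_pos))
  · intro method r hr N hN hNδ A hA w hw hmass g hg hg2
    subst hg
    have hS := Inpainting.admissible_stencil method hr hA hw hmass hg2
    refine ⟨Inpainting.existsUnique_isInpainted method hN hS hper, fun u hu p hp => ?_⟩
    have hN' : (0 : ℝ) < N := by exact_mod_cast hN
    have hrh : r * (1 / (N : ℝ)) ≤ δ := by
      rw [lt_div_iff₀ (by linarith)] at hNδ
      have : 0 < 1 / (N : ℝ) := by positivity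
      linarith
    set ρ := r / |(Inpainting.centerOfMass method r A w).2| with hρ
    have hρ0 : 0 ≤ ρ := by positivity
    have hle : ρ ≤ (⌈ρ⌉₊ : ℝ) + 1 := (Nat.le_ceil ρ).trans (by linarith)
    refine (hk ⌈ρ⌉₊ method r N A w u hS hN hrh hle hu p hp).trans ?_
    gcongr
    exact (hF ρ hρ0).trans
      (le_add_of_nonneg_right (inv_nonneg.2 (Inpainting.sin_lineAngle_nonneg _)))
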